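/- **Setting.** An $A1$-space $\mathbf E$ is a family of complex Banach spaces $E_{n,t}$ ($n\in\overline{\mathbb N}=\mathbb N\cup\{\infty\}$, $t\in\mathbb R_{>0}$) with functorial restriction maps $\iota:E_{n,t}\to E_{m,s}$ ($n\le m$, $s\le t$) of norm $\le 1$; subspaces are closed and stable under restriction. Fix $k>0$ and put $\lambda(s,t)=s^k(t-s)$. A $1$-local operator of $E_n$ over $]0,q]$ is a family $u=(u_{rs}:E_{n,s}\to E_{n,r})_{r<s\le q}$ compatible with restrictions, with $|u|_q=\sup_{r<s\le q}e\,\lambda(r,s)\|u_{rs}\|<\infty$. If $|u|_q<\lambda(s,q)$, then $e^{u}=\sum_i u^i/i!:E_{n,q}\to E_{n,s}$ is defined. An Arnold action $(\mathbf E,\mathbf f+\mathbf M,\mathfrak g_\lambda)$ consists of $\mathbf E$, a horizontal section $f$ of $\mathbf E$, a subspace $\mathbf M\subset\mathbf E$, and, for every $n\in\mathbb N$ and $q>0$, a closed subspace $\mathfrak g_{n,q}$ (stable under restriction) of the $1$-local operators of $E_n$ over $]0,q]$, such that $u(f)\in M_n$, $u(M_n)\subset M_n$ for $u\in\mathfrak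 g_n$, and $e^u$ maps $M_{n,q}$ to $M_{n,s}$ when $|u|_q<\lambda(s,q)$. Let $\mathbf T\subset\mathbf M$ be a subspace (transversal) with a projector $\pi$, i.e. linear maps $\pi_{n,st}:M_{n,t}\to T_{n,s}$ ($s<t$), compatible with all restrictions and equal to $\iota$ on $\mathbf T$. Let $j$ assign to every $\delta\in T_{n,u}$ with $|\delta|\le1$ linear maps $j_n(\delta)_{qp}:M_{n,p}\to\mathfrak g_{n,q}$ ($q<p<u$), compatible with the restrictions in $u,p,q$, and put $$\kappa_n(\delta)(x)=(\iota-\pi)\bigl(x-j_n(\delta)(x)(f+\delta)\bigr).$$ For pairs of real exponents $\alpha,\beta,\gamma,\nu,\xi$ and $S>0$ let $|\pi_n|_S$, $|j_n|_S$, $|\kappa_n|_S\in[0,\infty]$ be the suprema of $$s^{\alpha_1}(t-s)^{\alpha_2}\|\pi_{n,st}\|,\qquad \frac{u^{\beta_1}(u-p)^{\beta_2}q^{\gamma_1}(p-q)^{\gamma_2}\|j_n(\delta)_{qp}\|}{1+|\delta|},\qquad \frac{u^{\nu_1}(u-t)^{\nu_2}s^{\xi_1}(t-s)^{\xi_2}(t/s)^{2^n}\|\kappa_n(\delta)_{st}\|}{1+|\delta|}$$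 over $s<t\le S$, over $q<p<u\le S$, and over $s<t<u\le S$ respectively, and over $\delta\in T_{n,u}$, $|\delta|\le 1$ (norm $|\cdot|_q$ on $\mathfrak g_{n,q}$); the last weight expresses that $\kappa$ is a cutoff operator. A Bruno sequence is a strictly monotone positive sequence $a$ with $\sum_n|\log a_n|/2^{n+1}<\infty$. A sequence $b$ is strict if $0<b_n\le1$, $b_n\to0$ and $b_n^2\le b_{n+1}$. **The Lie iteration.** Let $s_0>s_1>\dots$ converge to $s_\infty>0$ and $r_0\in M_{0,s_0}$. Starting from $\tau_0=f$, $x_0=f+r_0$, put, for $n\ge 0$, $u_n=j_n(\tau_n-f)(r_n)$ and $$x_{n+1}=e^{-u_n}x_n,\quad \delta_{n+1}=\pi\bigl(r_n-u_n(\tau_n)\bigr),\quad \tau_{n+1}=\tau_n+\delta_{n+1},\quad r_{n+1}=x_{n+1}-\tau_{n+1},$$ all restricted to the fibre over $(n+1,s_{n+1})$. It is well defined if $|\tau_n-f|\le1$ for all $n$ and $|u_n|_q<\lambda(s_{n+1},q)$ for some $q\in\,]s_{n+1},s_n[$. It is convergent in $s^*\mathbf E$ if it is well defined, $(x_n)$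 and $(\tau_n)$ are Cauchy in $s^*\mathbf E$ and their images in $E_{\infty,s_\infty}$ converge to one point of $f+T_{\infty,s_\infty}$, and $|r_n|\to0$, $|\delta_n|\to0$. **Theorem.** Given $k>0$ and exponents $\alpha,\beta,\gamma,\nu,\xi$, there is $m>0$, depending only on them, such that the following holds. For $(\mathbf E,\mathbf f+\mathbf M,\mathfrak g_\lambda)$, $\mathbf T$, $\pi$, $j$ as above, suppose that for every $S>0$ each of the three sequences $|\pi_n|_S$, $|j_n|_S$, $|\kappa_n|_S$ is bounded above by a Bruno sequence. Then there is $\varepsilon>0$ such that for every strict decreasing Bruno sequence $b$ there is $\varepsilon_b\in\,]0,\varepsilon]$ such that for every $t>0$ there is a strictly decreasing sequence $s=(s_n)$ with $s_0=t$, converging to a positive limit, such that for every $r_0\in M_{0,t}$ with $|r_0|<\varepsilon\min(1,t)^m$ the Lie iteration is convergent in $s^*\mathbf E$, and if moreover $|r_0|<\varepsilon_b\min(1,t)^m$, then $|r_n|\le b_n$ and $|\delta_{n+1}|\le b_{n+1}$ for all $n\ge0$. -/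

import Mathlib

open Filter Topology
open scoped ENNReal

noncomputable section

/-- The base `ℝ_{>0}`. -/
abbrev Pos : Type := {t : ℝ // 0 < t}

namespace Pos

/-- The midpoint of two positive numbers. -/
def mid (a b : Pos) : Pos := ⟨((a : ℝ) + b) / 2, by have := a.2; have := b.2; positivity⟩

theorem lt_mid {a b : Pos} (h : a < b) : a < mid a b := by
  have h' : (a : ℝ) < b := h
  change (a : ℝ) < ((a : ℝ) + b) / 2
  linarith

theorem mid_lt {a b : Pos} (h : a < b) : mid a b < b := by
  have h' : (a : ℝ) < b := h
  change ((a : ℝ) + b) / 2 < (b : ℝ)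
  linarith

end Pos

/-! ### Bruno sequences -/

/-- Bruno sequences: strictly monotone positive sequences with `∑ |log a_k| / 2^(k+1) < ∞`. -/
def IsBruno (a : ℕ → ℝ) : Prop :=
  (StrictMono a ∨ StrictAnti a) ∧ (∀ n, 0 < a n) ∧
    Summable fun n => |Real.log (a n) / 2 ^ (n + 1)|

/-- Strict sequences: positive, at most `1`, tending to `0`, with `b_n ^ 2 ≤ b_{n+1}`. -/
def IsStrictSeq (b : ℕ → ℝ) : Prop :=
  (∀ n, 0 < b n) ∧ (∀ n, b n ≤ 1) ∧ Tendsto b atTop (𝓝 0) ∧ ∀ n, b n ^ 2 ≤ b (n + 1)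

/-- A sequence of (a priori possibly infinite) norms is controlled by a Bruno sequence. -/
def BrunoBounded (N : ℕ → ℝ≥0∞) : Prop :=
  ∃ a : ℕ → ℝ, IsBruno a ∧ ∀ n, N n ≤ ENNReal.ofReal (a n)

/-! ### A1-spaces and their subspaces -/

/-- An `A1`-space, with the vertex at infinity: a functor from `{0, 1, 2, …, ∞} × ℝ_{>0}` to complex
Banach spaces and linear maps of norm at most one, with restrictions
`E_{n,t} → E_{m,s}` for `n ≤ m`, `s ≤ t`. -/
structure A1Space where
  fib : ℕ∞ → Pos → Type*
  [normedAddCommGroup : ∀ n t, NormedAddCommGroup (fib n t)]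
  [normedSpace : ∀ n t, NormedSpace ℂ (fib n t)]
  [completeSpace : ∀ n t, CompleteSpace (fib n t)]
  res : ∀ {n m : ℕ∞} {t s : Pos}, n ≤ m → s ≤ t → (fib n t →L[ℂ] fib m s)
  res_self : ∀ {n : ℕ∞} {t : Pos} (x : fib n t), res (le_refl n) (le_refl t) x = x
  res_res : ∀ {n m l : ℕ∞} {t s r : Pos} (h₁ : n ≤ m) (h₂ : m ≤ l) (k₁ : s ≤ t) (k₂ : r ≤ s)
    (x : fib n t), res h₂ k₂ (res h₁ k₁ x) = res (h₁.trans h₂) (k₂.trans k₁) x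
  norm_res_le : ∀ {n m : ℕ∞} {t s : Pos} (h : n ≤ m) (k : s ≤ t) (x : fib n t),
    ‖res h k x‖ ≤ ‖x‖

attribute [instance] A1Space.normedAddCommGroup A1Space.normedSpace A1Space.completeSpace

/-- A (closed) sub-`A1`-space. -/
structure A1Subspace (E : A1Space) where
  car : ∀ (n : ℕ∞) (t : Pos), Submodule ℂ (E.fib n t)
  isClosed : ∀ n t, IsClosed (car n t : Set (E.fib n t))
  res_mem : ∀ {n m : ℕ∞} {t s : Pos} (h : n ≤ m) (k : s ≤ t) (x : E.fib n t),
    x ∈ car n t → E.res h k x ∈ car m s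

/-- Restriction maps of a subspace. -/
def A1Subspace.res {E : A1Space} (M : A1Subspace E) {n m : ℕ∞} {t s : Pos} (h : n ≤ m)
    (k : s ≤ t) (x : M.car n t) : M.car m s :=
  ⟨E.res h k x, M.res_mem h k x x.2⟩

/-- A global horizontal section, i.e. an initial vector. -/
structure InitialVector (E : A1Space) where
  val : ∀ (n : ℕ∞) (t : Pos), E.fib n t
  horizontal : ∀ {n m : ℕ∞} {t s : Pos} (h : n ≤ m) (k : s ≤ t), E.res h k (val n t) = val m s

/-! ### Local operators and exponentials -/

/-- Families of operators `u_{r,s} : E_{n,s} → E_{n,r}` for `r < s ≤ q`. -/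
abbrev OpFamily (E : A1Space) (n : ℕ) (q : Pos) : Type _ :=
  ∀ i : {i : Pos × Pos // i.1 < i.2 ∧ i.2 ≤ q}, E.fib n i.1.2 →L[ℂ] E.fib n i.1.1

/-- Families of operators `u_{r,s} : E_{n,s} → E_{n,r}` for `r < s < p`. -/
abbrev OpenOpFamily (E : A1Space) (n : ℕ) (p : Pos) : Type _ :=
  ∀ i : {i : Pos × Pos // i.1 < i.2 ∧ i.2 < p}, E.fib n i.1.2 →L[ℂ] E.fib n i.1.1

namespace OpFamily

variable {E : A1Space} {n : ℕ}

/-- The component `u_{r,s}`. -/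
abbrev comp {q : Pos} (u : OpFamily E n q) (r s : Pos) (hrs : r < s) (hs : s ≤ q) :
    E.fib n s →L[ℂ] E.fib n r :=
  u ⟨(r, s), hrs, hs⟩

/-- Compatibility of a family with all restrictions. -/
def IsHorizontal {q : Pos} (u : OpFamily E n q) : Prop :=
  ∀ (r' r s s' : Pos) (hr : r' ≤ r) (hrs : r < s) (hs : s ≤ s') (hq : s' ≤ q) (x : E.fib n s'),
    E.res le_rfl hr (comp u r s hrs (hs.trans hq) (E.res le_rfl hs x)) =
      comp u r' s' ((hr.trans_lt hrs).trans_le hs) hq x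

/-- Restriction of a family to a smaller interval. -/
def restrict {q q' : Pos} (h : q' ≤ q) (u : OpFamily E n q) : OpFamily E n q' :=
  fun i => comp u i.1.1 i.1.2 i.2.1 (i.2.2.trans h)

/-- The open family underlying a family. -/
def toOpen {q : Pos} (u : OpFamily E n q) : OpenOpFamily E n q :=
  fun i => comp u i.1.1 i.1.2 i.2.1 i.2.2.le

end OpFamily

/-- The submultiplicative weight function `λ(s, t) = s^k (t - s)`. -/
def lam (k : ℝ) (s t : Pos) : ℝ := (s : ℝ) ^ k * ((t : ℝ) - s)

/-- The weight `s^{α₁} (t - s)^{α₂}` attached to a pair of exponents. -/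
def weight (α : ℝ × ℝ) (s t : Pos) : ℝ := (s : ℝ) ^ α.1 * ((t : ℝ) - s) ^ α.2

/-- The weight `u^{β₁} (u - t)^{β₂}` for the dependence on a point over `u`. -/
def paramWeight (β : ℝ × ℝ) (t u : Pos) : ℝ := (u : ℝ) ^ β.1 * ((u : ℝ) - t) ^ β.2

/-- The norm of the fibre over `q` of the space of `1`-local operators, with respect to the weight
`λ₁ = e λ`: the supremum of `e λ(r,s) ‖u_{r,s}‖` over `r < s ≤ q`. -/
def locNorm (k : ℝ) {E : A1Space} {n : ℕ} {q : Pos} (u : OpFamily E n q) : ℝ≥0∞ :=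
  ⨆ (r : Pos) (s : Pos) (hrs : r < s) (hs : s ≤ q),
    ENNReal.ofReal (Real.exp 1 * lam k r s * ‖OpFamily.comp u r s hrs hs‖)

/-- `1`-local operators over `]0, q]`: horizontal families of finite norm. -/
def IsOneLocal (k : ℝ) {E : A1Space} {n : ℕ} {q : Pos} (u : OpFamily E n q) : Prop :=
  OpFamily.IsHorizontal u ∧ locNorm k u < ⊤

namespace OpenOpFamily

variable {E : A1Space} {n : ℕ} {p : Pos}

/-- The component `u_{r,s}`. -/
abbrev comp (u : OpenOpFamily E n p) (r s : Pos) (hrs : r < s) (hs : s < p) :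
    E.fib n s →L[ℂ] E.fib n r :=
  u ⟨(r, s), hrs, hs⟩

/-- Restriction of an open family to a closed interval below `p`. -/
def restrict {q : Pos} (h : q < p) (u : OpenOpFamily E n p) : OpFamily E n q :=
  fun i => comp u i.1.1 i.1.2 i.2.1 (i.2.2.trans_lt h)

/-- The powers `u^i : E_{n,p} → E_{n,r}`, composed through an intermediate point. For horizontal `u`
the result does not depend on the intermediate point. -/
def pow (u : OpenOpFamily E n p) : ℕ → ∀ r : Pos, r < p → (E.fib n p →L[ℂ] E.fib n r)
  | 0, _, h => E.res le_rfl h.le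
  | i + 1, r, h => (comp u r (Pos.mid r p) (Pos.lt_mid h) (Pos.mid_lt h)).comp
      (pow u i (Pos.mid r p) (Pos.mid_lt h))

/-- The exponential `e^u x = ∑ u^i x / i!`. It is only used where the series converges
absolutely, i.e. where `u` is smaller than the weight function. -/
def exp (u : OpenOpFamily E n p) {r : Pos} (h : r < p) (x : E.fib n p) : E.fib n r :=
  ∑' i : ℕ, ((i.factorial : ℂ)⁻¹) • pow u i r h x

/-- The value `u(x)` over `r`, of an open family on an element over `p`; for horizontal `u`
the result does not depend on the intermediate point. -/
def applyAt (u : OpenOpFamily E n p) {r : Pos} (h : r < p) (x : E.fib n p) : E.fib n r :=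
  comp u r (Pos.mid r p) (Pos.lt_mid h) (Pos.mid_lt h) (E.res le_rfl (Pos.mid_lt h).le x)

end OpenOpFamily

/-! ### Arnold actions -/

/-- An Arnold action `(E, f + M, 𝔤)` for the weight function `λ = s^k (t - s)`. Each `𝔤_n` is a
Kolmogorov subspace (closed, stable under restriction) of the space of `1`-local operators of `E_n`;
no compatibility between different `n` is required. -/
structure ArnoldAction (k : ℝ) where
  E : A1Space
  f : InitialVector E
  M : A1Subspace E
  g : ∀ (n : ℕ) (q : Pos), Submodule ℂ (OpFamily E n q)
  g_local : ∀ {n : ℕ} {q : Pos} (u : OpFamily E n q), u ∈ g n q → IsOneLocal k u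
  g_closed : ∀ {n : ℕ} {q : Pos} (u : OpFamily E n q), IsOneLocal k u →
    (∀ η : ℝ≥0∞, 0 < η → ∃ v ∈ g n q, locNorm k (u - v) < η) → u ∈ g n q
  g_restrict : ∀ {n : ℕ} {q q' : Pos} (h : q' ≤ q) (u : OpFamily E n q),
    u ∈ g n q → OpFamily.restrict h u ∈ g n q'
  act_f : ∀ {n : ℕ} {q : Pos} (u : OpFamily E n q), u ∈ g n q →
    ∀ (r s : Pos) (hrs : r < s) (hs : s ≤ q), OpFamily.comp u r s hrs hs (f.val n s) ∈ M.car n r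
  act_M : ∀ {n : ℕ} {q : Pos} (u : OpFamily E n q), u ∈ g n q →
    ∀ (r s : Pos) (hrs : r < s) (hs : s ≤ q) (x : E.fib n s), x ∈ M.car n s →
      OpFamily.comp u r s hrs hs x ∈ M.car n r
  exp_M : ∀ {n : ℕ} {q : Pos} (u : OpFamily E n q), u ∈ g n q →
    ∀ (r : Pos) (hr : r < q), locNorm k u < ENNReal.ofReal (lam k r q) →
      ∀ x ∈ M.car n q, OpenOpFamily.exp (OpFamily.toOpen u) hr x ∈ M.car n r

/-- A transversal `T ⊂ M` with a projector `π : M → T`, i.e. a horizontal family of operators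
`π_{n,s,t} : M_{n,t} → M_{n,s}`, `s < t`, with values in `T`, which is the restriction on `T`. -/
structure Transversal {k : ℝ} (A : ArnoldAction k) where
  T : A1Subspace A.E
  T_le_M : ∀ n t, T.car n t ≤ A.M.car n t
  proj : ∀ (n : ℕ∞) {s t : Pos}, s < t → (A.M.car n t →L[ℂ] A.M.car n s)
  proj_mem : ∀ (n : ℕ∞) {s t : Pos} (h : s < t) (x : A.M.car n t),
    (proj n h x : A.E.fib n s) ∈ T.car n s
  proj_T : ∀ (n : ℕ∞) {s t : Pos} (h : s < t) (x : A.M.car n t), (x : A.E.fib n t) ∈ T.car n t →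
    proj n h x = A.M.res le_rfl h.le x
  proj_horizontal : ∀ {n m : ℕ∞} {s' s t t' : Pos} (hn : n ≤ m) (hs : s' ≤ s) (h : s < t)
    (ht : t ≤ t') (x : A.M.car n t'),
    A.M.res hn hs (proj n h (A.M.res le_rfl ht x)) =
      proj m ((hs.trans_lt h).trans_le ht) (A.M.res hn le_rfl x)

/-- Operator-valued maps `j_n` from the unit ball of `T_n` to local operators from `M_n` to `𝔤_n`.
For `δ` in the unit ball of `T_{n,u}`, `j_n(δ)` is a horizontal family of linear maps
`M_{n,p} → 𝔤_{n,q}`, `q < p < u`, compatible with restriction of `δ`. Values outside the unit ball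
are irrelevant. -/
structure LocalInverse {k : ℝ} {A : ArnoldAction k} (Tr : Transversal A) where
  op : ∀ (n : ℕ) {u : Pos} (_ : Tr.T.car n u) {q p : Pos}, q < p → p < u →
    (A.M.car n p →ₗ[ℂ] OpFamily A.E n q)
  op_mem : ∀ (n : ℕ) {u : Pos} (δ : Tr.T.car n u), ‖δ‖ ≤ 1 →
    ∀ {q p : Pos} (hqp : q < p) (hpu : p < u) (x : A.M.car n p), op n δ hqp hpu x ∈ A.g n q
  op_horizontal : ∀ (n : ℕ) {u : Pos} (δ : Tr.T.car n u), ‖δ‖ ≤ 1 →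
    ∀ {q' q p p' : Pos} (hq : q' ≤ q) (hqp : q < p) (hp : p ≤ p') (hpu : p' < u)
      (x : A.M.car n p'),
      OpFamily.restrict hq (op n δ hqp (hp.trans_lt hpu) (A.M.res le_rfl hp x)) =
        op n δ ((hq.trans_lt hqp).trans_le hp) hpu x
  op_res : ∀ (n : ℕ) {u u' : Pos} (δ : Tr.T.car n u), ‖δ‖ ≤ 1 →
    ∀ {q p : Pos} (hqp : q < p) (hpu : p < u') (hu : u' ≤ u),
      op n (Tr.T.res le_rfl hu δ) hqp hpu = op n δ hqp (hpu.trans_le hu)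

namespace LocalInverse

variable {k : ℝ} {A : ArnoldAction k} {Tr : Transversal A} (J : LocalInverse Tr)

/-- The infinitesimal generator `j(δ)(x)`, for `δ ∈ T_{n,u}` and `x ∈ M_{n,p}`, `p ≤ u`, as a family of
operators over `]0, p[`. -/
def gen (n : ℕ) {u p : Pos} (hpu : p ≤ u) (δ : Tr.T.car n u) (x : A.M.car n p) :
    OpenOpFamily A.E n p :=
  fun i =>
    OpFamily.comp (J.op n δ (Pos.lt_mid i.2.2) ((Pos.mid_lt i.2.2).trans_le hpu)
      (A.M.res le_rfl (Pos.mid_lt i.2.2).le x)) i.1.1 i.1.2 i.2.1 le_rfl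

/-- The remainder `x - j(δ)(x)(f + δ)` over `r < p`, as an element of `M`. -/
def remainder (n : ℕ) {u p : Pos} (hpu : p ≤ u) (δ : Tr.T.car n u) (hδ : ‖δ‖ ≤ 1)
    (x : A.M.car n p) {r : Pos} (hr : r < p) : A.M.car n r :=
  A.M.res le_rfl hr.le x -
    ⟨OpenOpFamily.applyAt (J.gen n hpu δ x) hr
        (A.f.val n p + A.E.res le_rfl hpu (δ : A.E.fib n u)), by
      have hmem := J.op_mem n δ hδ (Pos.lt_mid (Pos.mid_lt hr))
        ((Pos.mid_lt (Pos.mid_lt hr)).trans_le hpu)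
        (A.M.res le_rfl (Pos.mid_lt (Pos.mid_lt hr)).le x)
      simp only [OpenOpFamily.applyAt, map_add, gen]
      refine Submodule.add_mem _ ?_ ?_
      · rw [A.f.horizontal]
        exact A.act_f _ hmem _ _ _ _
      · exact A.act_M _ hmem _ _ _ _ _
          (A.M.res_mem _ _ _ (A.M.res_mem _ _ _ (Tr.T_le_M _ _ δ.2)))⟩

/-- The normal form increment `π(x - j(δ)(x)(f + δ))` over `r < p`. -/
def incr (n : ℕ) {u p : Pos} (hpu : p ≤ u) (δ : Tr.T.car n u) (hδ : ‖δ‖ ≤ 1)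
    (x : A.M.car n p) {r : Pos} (hr : r < p) : A.M.car n r :=
  Tr.proj n (Pos.lt_mid hr) (J.remainder n hpu δ hδ x (Pos.mid_lt hr))

/-- The defect `κ(δ)(x) = (ι - π)(x - j(δ)(x)(f + δ))` over `r < p`. -/
def defect (n : ℕ) {u p : Pos} (hpu : p ≤ u) (δ : Tr.T.car n u) (hδ : ‖δ‖ ≤ 1)
    (x : A.M.car n p) {r : Pos} (hr : r < p) : A.M.car n r :=
  J.remainder n hpu δ hδ x hr - J.incr n hpu δ hδ x hr

/-- The norm of `j_n` over `]0, S]`, in the space of local maps with weights `β` from the unit ball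
of `T_n` to local operators with weights `γ` from `M_n` to `𝔤_n`. -/
def norm (β γ : ℝ × ℝ) (S : Pos) (n : ℕ) : ℝ≥0∞ :=
  ⨆ (u : Pos) (_ : u ≤ S) (δ : Tr.T.car n u) (_ : ‖δ‖ ≤ 1) (q : Pos) (p : Pos) (hqp : q < p)
    (hpu : p < u) (x : A.M.car n p) (_ : ‖x‖ ≤ 1),
    ENNReal.ofReal (paramWeight β p u * weight γ q p / (1 + ‖δ‖)) *
      locNorm k (J.op n δ hqp hpu x)

/-- The norm of `κ_n` over `]0, S]`, in the space of local maps with weights `ν` from the unit ball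
of `T_n` to cutoff operators, i.e. local operators for the weight
`(t/s)^(2^n) s^{ξ₁} (t - s)^{ξ₂}`, from `M_n` to `M_n`. -/
def defectNorm (ν ξ : ℝ × ℝ) (S : Pos) (n : ℕ) : ℝ≥0∞ :=
  ⨆ (u : Pos) (_ : u ≤ S) (δ : Tr.T.car n u) (hδ : ‖δ‖ ≤ 1) (s : Pos) (t : Pos) (hst : s < t)
    (htu : t < u) (x : A.M.car n t) (_ : ‖x‖ ≤ 1),
    ENNReal.ofReal (paramWeight ν t u * weight ξ s t * ((t : ℝ) / s) ^ (2 ^ n) / (1 + ‖δ‖) *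
      ‖J.defect n htu.le δ hδ x hst‖)

end LocalInverse

/-- The norm of `π_n` over `]0, S]` as a local operator with weights `α`. -/
def Transversal.projNorm {k : ℝ} {A : ArnoldAction k} (Tr : Transversal A) (α : ℝ × ℝ) (S : Pos)
    (n : ℕ) : ℝ≥0∞ :=
  ⨆ (s : Pos) (t : Pos) (hst : s < t) (_ : t ≤ S),
    ENNReal.ofReal (weight α s t * ‖Tr.proj n hst‖)

/-! ### The Lie iteration -/

/-- Falling sequences in `ℝ_{>0}` converging in `ℝ_{>0}`. -/
structure FallingSeq where
  val : ℕ → Pos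
  anti : StrictAnti val
  lim : Pos
  tendsto : Tendsto val atTop (𝓝 lim)

theorem FallingSeq.lim_le (s : FallingSeq) (n : ℕ) : s.lim ≤ s.val n :=
  s.anti.antitone.le_of_tendsto s.tendsto n

theorem FallingSeq.succ_lt (s : FallingSeq) (n : ℕ) : s.val (n + 1) < s.val n :=
  s.anti (Nat.lt_succ_self n)

theorem coe_le_coe_succ (n : ℕ) : (n : ℕ∞) ≤ ((n + 1 : ℕ) : ℕ∞) :=
  Nat.cast_le.2 (Nat.le_succ n)

/-- Sections of the pull-back `s^*E` over `ℕ`. -/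
abbrev PullbackSection (E : A1Space) (s : FallingSeq) : Type _ :=
  ∀ n : ℕ, E.fib n (s.val n)

/-- Cauchy sections of `s^*E`. -/
def PullbackSection.IsCauchy {E : A1Space} {s : FallingSeq} (x : PullbackSection E s) : Prop :=
  ∀ η : ℝ, 0 < η → ∃ N : ℕ, ∀ n m : ℕ, N ≤ n → ∀ h : n ≤ m,
    ‖E.res (Nat.cast_le.2 h) (s.anti.antitone h) (x n) - x m‖ < η

/-- Convergence of a section of `s^*E` to a point of the fibre at infinity. -/
def PullbackSection.ConvergesTo {E : A1Space} {s : FallingSeq} (x : PullbackSection E s)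
    (y : E.fib ⊤ s.lim) : Prop :=
  Tendsto (fun n => E.res le_top (s.lim_le n) (x n)) atTop (𝓝 y)

/-- A (well-defined, infinite) Lie iteration along the falling sequence `s`. Here
`τ_n = f + d_n` with `d_n` in the unit ball of `T`, `x_n = τ_n + r_n`, `u_n = j(τ_n)(r_n)`,
`inc n` is `δ_{n+1}`, and

* `u_n` is small enough to be exponentiated from some point below `s_n` down to `s_{n+1}`;
* `δ_{n+1} = π(r_n - u_n(τ_n))`, `τ_{n+1} = τ_n + δ_{n+1}`, `x_{n+1} = e^{-u_n} x_n`. -/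
structure LieIteration {k : ℝ} {A : ArnoldAction k} {Tr : Transversal A} (J : LocalInverse Tr)
    (s : FallingSeq) where
  d : ∀ n : ℕ, Tr.T.car n (s.val n)
  r : ∀ n : ℕ, A.M.car n (s.val n)
  inc : ∀ n : ℕ, Tr.T.car (n + 1 : ℕ) (s.val (n + 1))
  d_zero : d 0 = 0
  d_le : ∀ n, ‖d n‖ ≤ 1
  small : ∀ n : ℕ, ∃ (q : Pos) (hq : q < s.val n), s.val (n + 1) < q ∧
    locNorm k (OpenOpFamily.restrict hq (J.gen n le_rfl (d n) (r n))) <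
      ENNReal.ofReal (lam k (s.val (n + 1)) q)
  inc_eq : ∀ n : ℕ, (inc n : A.E.fib (n + 1 : ℕ) (s.val (n + 1))) =
    A.E.res (coe_le_coe_succ n) le_rfl
      (J.incr n le_rfl (d n) (d_le n) (r n) (s.succ_lt n) : A.E.fib n (s.val (n + 1)))
  d_succ : ∀ n : ℕ, d (n + 1) = Tr.T.res (coe_le_coe_succ n) (s.succ_lt n).le (d n) + inc n
  x_succ : ∀ n : ℕ, A.f.val (n + 1 : ℕ) (s.val (n + 1)) + d (n + 1) + r (n + 1) =
    A.E.res (coe_le_coe_succ n) le_rfl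
      (OpenOpFamily.exp (-(J.gen n le_rfl (d n) (r n))) (s.succ_lt n)
        (A.f.val n (s.val n) + d n + r n))

namespace LieIteration

variable {k : ℝ} {A : ArnoldAction k} {Tr : Transversal A} {J : LocalInverse Tr} {s : FallingSeq}

/-- The section `τ_n = f + d_n`. -/
def tau (L : LieIteration J s) : PullbackSection A.E s := fun n => A.f.val n (s.val n) + L.d n

/-- The section `x_n = τ_n + r_n`. -/
def x (L : LieIteration J s) : PullbackSection A.E s := fun n => L.tau n + L.r n

/-- Convergence of the Lie iteration in `s^*E` to a normal form: `x_n` and `τ_n` are Cauchy and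
converge to the same point of `f + T`, while `r_n` and `δ_n` tend to zero. -/
def Converges (L : LieIteration J s) : Prop :=
  L.x.IsCauchy ∧ L.tau.IsCauchy ∧
  (∃ y ∈ Tr.T.car ⊤ s.lim,
    L.x.ConvergesTo (A.f.val ⊤ s.lim + y) ∧ L.tau.ConvergesTo (A.f.val ⊤ s.lim + y)) ∧
  Tendsto (fun n => ‖L.r n‖) atTop (𝓝 0) ∧ Tendsto (fun n => ‖L.inc n‖) atTop (𝓝 0)

end LieIteration

end

/-! The proof carries a bound on the whole function `s ↦ ‖r_n‖_s`, not on one norm. With radii `P n`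
decreasing to a positive limit, the remainder after `n` steps satisfies `‖r_n‖_s ≤ H * G n * (s / P
n) ^ profileOrder n` for all `L ≤ s ≤ P n`, where the order is `2^(n-1)` (and `0` for `n = 0`). This
is `InProfile`.

Writing `w = f + d` and `u = j(d)(r)`, one step gives `e^{-u}(w + r) - w - π(r - u w) = κ(d)(r) +
(second order in r)`. The cutoff term carries a factor `(s/t)^(2^n)`, and the second order term
squares the old profile. Both therefore have order `2^n = profileOrder (n + 1)`, so the shape
reproduces itself. Evaluating at radii enlarged by `stepRatio n = 2^(1/2^n)` costs only a factor `2`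
after raising to the power `2^n`, and leaves gaps of size about `L/2^n` for the local norms. All
constants of a step are thus bounded by `B n / L ^ N`, where `log (B n) / 2^n` is summable by the
Bruno hypothesis. They are cancelled by shrinking the radius: `(P (n+1) / P n)^(2^n)` beats the
square of the constant, and the same summability keeps the limit of `P` positive.

The factor `L ^ (-N)` makes this circular, since `L` has to lie below the limit of the radii. Its
total cost is proportional to `N * log (1/L) * ∑ 2^(-n)`, which is harmless if only `n ≥ n₀`
contribute. The first `n₀` steps are instead paid for by tiny amplitudes `G n`; this produces the
power `min(1,t)^m` in the smallness condition (`exists_isSchedule`).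

Reading the result at `P n / 2` gives `‖r_n‖ ≤ H * 2^(-2^(n-1))` for `n ≥ 1`, a decay that no Bruno
sequence outruns up to a constant (`IsBruno.exists_half_pow_le`). As `H` is proportional to `‖r₀‖`,
that constant is absorbed by `ε_b`. The step estimates are `norm_incr_le`, `norm_defect_le` and
`exp_estimate`; `exists_step` is the induction step, `exists_lieIteration` the iteration. -/

noncomputable section

/-! ### Restriction maps of subspaces. -/

namespace A1Subspace

variable {E : A1Space} (M : A1Subspace E)

@[simp] theorem coe_res {n m : ℕ∞} {t s : Pos} (h : n ≤ m) (k : s ≤ t) (x : M.car n t) :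
    (M.res h k x : E.fib m s) = E.res h k x := rfl

theorem norm_res_le {n m : ℕ∞} {t s : Pos} (h : n ≤ m) (k : s ≤ t) (x : M.car n t) :
    ‖M.res h k x‖ ≤ ‖x‖ := E.norm_res_le h k x

theorem res_self {n : ℕ∞} {t : Pos} (x : M.car n t) : M.res (le_refl n) (le_refl t) x = x :=
  Subtype.ext (E.res_self _)

theorem res_res {n m l : ℕ∞} {t s r : Pos} (h₁ : n ≤ m) (h₂ : m ≤ l) (k₁ : s ≤ t) (k₂ : r ≤ s)
    (x : M.car n t) : M.res h₂ k₂ (M.res h₁ k₁ x) = M.res (h₁.trans h₂) (k₂.trans k₁) x :=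
  Subtype.ext (E.res_res _ _ _ _ _)

theorem res_smul {n m : ℕ∞} {t s : Pos} (h : n ≤ m) (k : s ≤ t) (c : ℂ) (x : M.car n t) :
    M.res h k (c • x) = c • M.res h k x :=
  Subtype.ext ((E.res h k).map_smul c x)

end A1Subspace

/-! ### Horizontal families of operators, their powers and exponentials. -/

namespace OpenOpFamily

variable {E : A1Space} {n : ℕ} {p : Pos}

/-- Compatibility of an open family with all restrictions. -/
def IsHorizontal (U : OpenOpFamily E n p) : Prop :=
  ∀ (r' r s s' : Pos) (hr : r' ≤ r) (hrs : r < s) (hs : s ≤ s') (hp : s' < p) (x : E.fib n s'),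
    E.res le_rfl hr (comp U r s hrs (hs.trans_lt hp) (E.res le_rfl hs x)) =
      comp U r' s' ((hr.trans_lt hrs).trans_le hs) hp x

theorem IsHorizontal.comp_res {U : OpenOpFamily E n p} (hU : U.IsHorizontal) {r s s' : Pos}
    (hrs : r < s) (hs : s ≤ s') (hp : s' < p) (x : E.fib n s') :
    comp U r s hrs (hs.trans_lt hp) (E.res le_rfl hs x) = comp U r s' (hrs.trans_le hs) hp x := by
  have := hU r r s s' le_rfl hrs hs hp x
  rwa [E.res_self] at this

theorem IsHorizontal.res_comp {U : OpenOpFamily E n p} (hU : U.IsHorizontal) {r' r s : Pos}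
    (hr : r' ≤ r) (hrs : r < s) (hp : s < p) (x : E.fib n s) :
    E.res le_rfl hr (comp U r s hrs hp x) = comp U r' s (hr.trans_lt hrs) hp x := by
  have := hU r' r s s hr hrs le_rfl hp x
  rwa [E.res_self] at this

theorem IsHorizontal.neg {U : OpenOpFamily E n p} (hU : U.IsHorizontal) :
    (-U).IsHorizontal := by
  intro r' r s s' hr hrs hs hp x
  have := hU r' r s s' hr hrs hs hp x
  simp only [comp, Pi.neg_apply, _root_.neg_apply, map_neg] at this ⊢
  rw [this]

theorem comp_neg (U : OpenOpFamily E n p) {r s : Pos} (hrs : r < s) (hs : s < p) (x : E.fib n s) :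
    comp (-U) r s hrs hs x = -comp U r s hrs hs x := rfl

theorem pow_zero_apply (U : OpenOpFamily E n p) {r : Pos} (h : r < p) (x : E.fib n p) :
    pow U 0 r h x = E.res le_rfl h.le x := rfl

theorem IsHorizontal.res_pow {U : OpenOpFamily E n p} (hU : U.IsHorizontal) (i : ℕ) {r' r : Pos}
    (hr : r' ≤ r) (h : r < p) (x : E.fib n p) :
    E.res le_rfl hr (pow U i r h x) = pow U i r' (hr.trans_lt h) x := by
  induction i generalizing r r' with
  | zero => exact E.res_res _ _ _ _ _
  | succ i ih =>
    have hmid : Pos.mid r' p ≤ Pos.mid r p := by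
      change ((r' : ℝ) + p) / 2 ≤ ((r : ℝ) + p) / 2
      have : (r' : ℝ) ≤ r := hr
      linarith
    change E.res le_rfl hr (comp U r (Pos.mid r p) _ _ (pow U i (Pos.mid r p) _ x)) =
      comp U r' (Pos.mid r' p) _ _ (pow U i (Pos.mid r' p) _ x)
    rw [hU.res_comp, ← ih hmid (Pos.mid_lt h), hU.comp_res]

/-- Two choices of intermediate point are compared through their minimum: horizontality lets both
compositions pass through that common smaller point. -/
theorem IsHorizontal.pow_succ_apply {U : OpenOpFamily E n p} (hU : U.IsHorizontal) (i : ℕ)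
    {r m : Pos} (hr : r < m) (hm : m < p) (x : E.fib n p) :
    pow U (i + 1) r (hr.trans hm) x = comp U r m hr hm (pow U i m hm x) := by
  have h := hr.trans hm
  change comp U r (Pos.mid r p) (Pos.lt_mid h) (Pos.mid_lt h) (pow U i (Pos.mid r p) _ x) = _
  have h₁ : r < min m (Pos.mid r p) := lt_min hr (Pos.lt_mid h)
  rw [← hU.comp_res h₁ (min_le_left _ _) hm, ← hU.comp_res h₁ (min_le_right _ _) (Pos.mid_lt h),
    hU.res_pow, hU.res_pow]

theorem IsHorizontal.applyAt_eq {U : OpenOpFamily E n p} (hU : U.IsHorizontal)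
    {r m : Pos} (hr : r < m) (hm : m < p) (x : E.fib n p) :
    applyAt U (hr.trans hm) x = comp U r m hr hm (E.res le_rfl hm.le x) :=
  hU.pow_succ_apply 0 hr hm x

theorem IsHorizontal.res_applyAt {U : OpenOpFamily E n p} (hU : U.IsHorizontal) {r' r : Pos}
    (hr : r' ≤ r) (h : r < p) (x : E.fib n p) :
    E.res le_rfl hr (applyAt U h x) = applyAt U (hr.trans_lt h) x :=
  hU.res_pow 1 hr h x

/-- Two open families agree on the smaller of their intervals. -/
def Agree {p' : Pos} (hp : p' ≤ p) (V : OpenOpFamily E n p') (U : OpenOpFamily E n p) : Prop :=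
  ∀ (r s : Pos) (hrs : r < s) (hs : s < p'), comp V r s hrs hs = comp U r s hrs (hs.trans_le hp)

theorem Agree.neg {p' : Pos} {hp : p' ≤ p} {V : OpenOpFamily E n p'} {U : OpenOpFamily E n p}
    (h : Agree hp V U) : Agree hp (-V) (-U) := fun r s hrs hs =>
  congrArg Neg.neg (h r s hrs hs)

/-- Used to move the starting point of a computation down to a smaller radius, where the norm
estimates are available. -/
theorem Agree.pow_res {p' : Pos} {hp : p' ≤ p} {V : OpenOpFamily E n p'} {U : OpenOpFamily E n p}
    (h : Agree hp V U) (hU : U.IsHorizontal) (i : ℕ) {r : Pos} (hr : r < p') (x : E.fib n p) :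
    pow V i r hr (E.res le_rfl hp x) = pow U i r (hr.trans_le hp) x := by
  induction i generalizing r with
  | zero => exact E.res_res _ _ _ _ _
  | succ i ih =>
    rw [hU.pow_succ_apply i (Pos.lt_mid hr) ((Pos.mid_lt hr).trans_le hp), ← ih (Pos.mid_lt hr),
      ← h]
    rfl

theorem Agree.applyAt_res {p' : Pos} {hp : p' ≤ p} {V : OpenOpFamily E n p'}
    {U : OpenOpFamily E n p} (h : Agree hp V U) (hU : U.IsHorizontal) {r : Pos} (hr : r < p')
    (x : E.fib n p) :
    applyAt V hr (E.res le_rfl hp x) = applyAt U (hr.trans_le hp) x :=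
  h.pow_res hU 1 hr x

theorem Agree.exp_res {p' : Pos} {hp : p' ≤ p} {V : OpenOpFamily E n p'} {U : OpenOpFamily E n p}
    (h : Agree hp V U) (hU : U.IsHorizontal) {r : Pos} (hr : r < p') (x : E.fib n p) :
    exp V hr (E.res le_rfl hp x) = exp U (hr.trans_le hp) x := by
  simp only [exp, h.pow_res hU]

/-- The terms of the exponential series. -/
def expTerm (U : OpenOpFamily E n p) {r : Pos} (h : r < p) (x : E.fib n p) (i : ℕ) : E.fib n r :=
  ((i.factorial : ℂ)⁻¹) • pow U i r h x

theorem expTerm_zero (U : OpenOpFamily E n p) {r : Pos} (h : r < p) (x : E.fib n p) :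
    expTerm U h x 0 = E.res le_rfl h.le x := by
  simp [expTerm, pow_zero_apply]

theorem expTerm_one (U : OpenOpFamily E n p) {r : Pos} (h : r < p) (x : E.fib n p) :
    expTerm U h x 1 = applyAt U h x := by
  simp only [expTerm, Nat.factorial_one, Nat.cast_one, inv_one, one_smul]
  rfl

theorem exp_eq_tsum (U : OpenOpFamily E n p) {r : Pos} (h : r < p) (x : E.fib n p) :
    exp U h x = ∑' i, expTerm U h x i := rfl

theorem IsHorizontal.res_exp {U : OpenOpFamily E n p} (hU : U.IsHorizontal) {r' r : Pos}
    (hr : r' ≤ r) (h : r < p) (x : E.fib n p) (hs : Summable (expTerm U h x)) :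
    E.res le_rfl hr (exp U h x) = exp U (hr.trans_lt h) x := by
  rw [exp_eq_tsum, ContinuousLinearMap.map_tsum _ hs]
  refine tsum_congr fun i => ?_
  rw [expTerm, map_smul, hU.res_pow]

variable {k : ℝ}

/-- Factor `u^i` through `i` equal steps of length `h = (q - r)/i`. Each costs at most `C / (e r^k
h)`, because `y^k` is smallest at `y = r` for `k > 0`. The product is `(i/e)^i (C/λ(r,q))^i`, and
`i^i ≤ e^i i!`. The factor `e` in the local norm is there to cancel this Stirling factor. -/
theorem IsHorizontal.norm_pow_le (hk : 0 < k) {U : OpenOpFamily E n p} (hU : U.IsHorizontal)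
    {r q : Pos} (hr : r < q) (hq : q < p) {C : ℝ}
    (hC : ∀ (r s : Pos) (hrs : r < s) (hs : s ≤ q),
      Real.exp 1 * lam k r s * ‖comp U r s hrs (hs.trans_lt hq)‖ ≤ C)
    (i : ℕ) (x : E.fib n p) :
    ‖pow U i r (hr.trans hq) x‖ ≤ i.factorial * (C / lam k r q) ^ i * ‖x‖ := by
  rcases Nat.eq_zero_or_pos i with rfl | hi
  · simpa [pow_zero_apply] using E.norm_res_le le_rfl (hr.trans hq).le x
  have hi' : (0 : ℝ) < i := by exact_mod_cast hi
  have hrq : (0 : ℝ) < (q : ℝ) - r := sub_pos.2 hr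
  have hr0 : (0 : ℝ) < r := r.2
  have hrk : 0 < (r : ℝ) ^ k := Real.rpow_pos_of_pos hr0 k
  set h : ℝ := ((q : ℝ) - r) / i with hh
  have hpos : 0 < h := div_pos hrq hi'
  have hC0 : 0 ≤ C := by
    refine le_trans ?_ (hC r q hr le_rfl)
    have : 0 < lam k r q := mul_pos hrk hrq
    positivity
  set D : ℝ := C / (Real.exp 1 * ((r : ℝ) ^ k * h)) with hD
  have hD0 : 0 ≤ D := by positivity
  -- Downward induction over the grid points `q - j h`; the point is a variable with an equation, so
  -- that its fibre never has to be rewritten.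
  have key : ∀ j : ℕ, ∀ y : Pos, ∀ hy : y < p, (y : ℝ) = q - j * h → r ≤ y →
      ‖pow U j y hy x‖ ≤ D ^ j * ‖x‖ := by
    intro j
    induction j with
    | zero =>
      intro y hy _ _
      simpa [pow_zero_apply] using E.norm_res_le le_rfl hy.le x
    | succ j ih =>
      intro y hy hyv hry
      let z : Pos := ⟨y + h, by have := y.2; positivity⟩
      have hzv : (z : ℝ) = q - j * h := by
        change (y : ℝ) + h = _
        rw [hyv]; push_cast; ring
      have hyz : y < z := by
        change (y : ℝ) < y + h
        linarith
      have hzq : z ≤ q := by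
        change (z : ℝ) ≤ q
        rw [hzv]
        have : (0 : ℝ) ≤ j * h := by positivity
        linarith
      rw [hU.pow_succ_apply j hyz (hzq.trans_lt hq)]
      have h₁ := ih z (hzq.trans_lt hq) hzv (hry.trans hyz.le)
      have h₂ : ‖comp U y z hyz (hzq.trans_lt hq)‖ ≤ D := by
        have h₃ := hC y z hyz hzq
        have h₄ : (r : ℝ) ^ k * h ≤ lam k y z := by
          have : (z : ℝ) - y = h := by change (y : ℝ) + h - y = h; ring
          rw [lam, this]
          gcongr
        rw [hD, le_div_iff₀ (by positivity)]
        refine le_trans ?_ h₃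
        rw [mul_comm]
        gcongr
      calc _ ≤ ‖comp U y z hyz (hzq.trans_lt hq)‖ * ‖pow U j z (hzq.trans_lt hq) x‖ :=
            ContinuousLinearMap.le_opNorm _ _
        _ ≤ D * (D ^ j * ‖x‖) := by gcongr
        _ = D ^ (j + 1) * ‖x‖ := by ring
  have hfin := key i r (hr.trans hq) (by rw [hh, mul_div_cancel₀ _ hi'.ne']; ring) le_rfl
  refine hfin.trans ?_
  gcongr
  have hDe : D = (i : ℝ) / Real.exp 1 * (C / lam k r q) := by
    rw [hD, hh, lam]; field_simp
  rw [hDe, mul_pow]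
  have hq0 : 0 ≤ C / lam k r q := div_nonneg hC0 (mul_pos hrk hrq).le
  gcongr
  rw [div_pow, ← Real.exp_nat_mul, mul_one, div_le_iff₀ (Real.exp_pos _)]
  have := Real.pow_div_factorial_le_exp (i : ℝ) hi'.le i
  rw [div_le_iff₀ (by positivity)] at this
  linarith

theorem IsHorizontal.norm_expTerm_le (hk : 0 < k) {U : OpenOpFamily E n p} (hU : U.IsHorizontal)
    {r q : Pos} (hr : r < q) (hq : q < p) {C : ℝ}
    (hC : ∀ (r s : Pos) (hrs : r < s) (hs : s ≤ q),
      Real.exp 1 * lam k r s * ‖comp U r s hrs (hs.trans_lt hq)‖ ≤ C)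
    (x : E.fib n p) (i : ℕ) :
    ‖expTerm U (hr.trans hq) x i‖ ≤ (C / lam k r q) ^ i * ‖x‖ := by
  have h := hU.norm_pow_le hk hr hq hC i x
  rw [expTerm, norm_smul, norm_inv, Complex.norm_natCast]
  have : (0 : ℝ) < i.factorial := by positivity
  rw [inv_mul_le_iff₀ this]
  linarith

theorem summable_of_geometric {F : Type*} [NormedAddCommGroup F] [CompleteSpace F] {g : ℕ → F}
    {y c : ℝ} (hy0 : 0 ≤ y) (hy : y ≤ 1 / 2) (h : ∀ i, ‖g i‖ ≤ y ^ i * c) : Summable g :=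
  .of_norm_bounded ((summable_geometric_of_lt_one hy0 (by linarith)).mul_right c) h

theorem norm_tsum_sub_range_le {F : Type*} [NormedAddCommGroup F] [CompleteSpace F] {g : ℕ → F}
    {y c : ℝ} (hy0 : 0 ≤ y) (hy : y ≤ 1 / 2) (hc : 0 ≤ c) (h : ∀ i, ‖g i‖ ≤ y ^ i * c) (j : ℕ) :
    ‖∑' i, g i - ∑ i ∈ Finset.range j, g i‖ ≤ 2 * y ^ j * c := by
  rw [← (summable_of_geometric hy0 hy h).sum_add_tsum_nat_add j, add_sub_cancel_left]
  have hs : HasSum (fun i => y ^ i * (y ^ j * c)) ((1 - y)⁻¹ * (y ^ j * c)) :=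
    (hasSum_geometric_of_lt_one hy0 (by linarith)).mul_right _
  refine (tsum_of_norm_bounded hs fun i => (h (i + j)).trans (le_of_eq (by ring))).trans ?_
  have : (1 - y)⁻¹ ≤ 2 := by
    rw [inv_le_comm₀ (by linarith) (by norm_num)]; linarith
  calc _ ≤ 2 * (y ^ j * c) := by gcongr
    _ = _ := by ring

/-- The second-order Taylor estimate for the exponential at `w + z`, where `z` is treated as a
quantity of the first order. -/
theorem IsHorizontal.norm_exp_sub_le (hk : 0 < k) {U : OpenOpFamily E n p} (hU : U.IsHorizontal)
    {r q : Pos} (hr : r < q) (hq : q < p) {C : ℝ}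
    (hC : ∀ (r s : Pos) (hrs : r < s) (hs : s ≤ q),
      Real.exp 1 * lam k r s * ‖comp U r s hrs (hs.trans_lt hq)‖ ≤ C)
    (hsmall : C / lam k r q ≤ 1 / 2) (w z : E.fib n p) :
    ‖exp U (hr.trans hq) (w + z) - E.res le_rfl (hr.trans hq).le (w + z)
        - applyAt U (hr.trans hq) w‖ ≤
      2 * (C / lam k r q) ^ 2 * ‖w‖ + 2 * (C / lam k r q) * ‖z‖ := by
  have hl : 0 < lam k r q := mul_pos (Real.rpow_pos_of_pos r.2 k) (sub_pos.2 hr)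
  have hC0 : 0 ≤ C := le_trans (by positivity) (hC r q hr le_rfl)
  have hy0 : 0 ≤ C / lam k r q := div_nonneg hC0 hl.le
  have hw := hU.norm_expTerm_le hk hr hq hC w
  have hz := hU.norm_expTerm_le hk hr hq hC z
  have e₁ := norm_tsum_sub_range_le hy0 hsmall (norm_nonneg w) hw 2
  have e₂ := norm_tsum_sub_range_le hy0 hsmall (norm_nonneg z) hz 1
  have hadd : exp U (hr.trans hq) (w + z) = exp U (hr.trans hq) w + exp U (hr.trans hq) z := by
    simp only [exp_eq_tsum]
    rw [← (summable_of_geometric hy0 hsmall hw).tsum_add (summable_of_geometric hy0 hsmall hz)]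
    refine tsum_congr fun i => ?_
    simp only [expTerm, map_add, smul_add]
  simp only [Finset.sum_range_succ, Finset.sum_range_zero, zero_add, expTerm_zero, expTerm_one,
    ← exp_eq_tsum, pow_one] at e₁ e₂
  rw [hadd, map_add]
  refine le_trans (le_of_eq ?_) ((norm_add_le _ _).trans (add_le_add e₁ e₂))
  congr 1
  abel

end OpenOpFamily

/-! ### Generators, remainder and defect: compatibility with restrictions and membership in `M`. -/

namespace LocalInverse

variable {k : ℝ} {A : ArnoldAction k} {Tr : Transversal A} (J : LocalInverse Tr) (n : ℕ)
  {u p : Pos}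

theorem op_mid_comp (δ : Tr.T.car n u) (hδ : ‖δ‖ ≤ 1) {p' p₁ : Pos} {r s q : Pos} (hp₁ : p₁ < u)
    (hrs : r < s) (hsq : s ≤ q) (hqp : q < p') (hp' : p' ≤ p₁) (x : A.M.car n p₁) :
    OpFamily.comp (J.op n δ hqp (hp'.trans_lt hp₁) (A.M.res le_rfl hp' x)) r s hrs hsq =
      OpFamily.comp (J.op n δ ((hsq.trans_lt hqp).trans_le hp') hp₁ x) r s hrs le_rfl := by
  rw [← J.op_horizontal n δ hδ hsq hqp hp' hp₁ x]
  rfl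

/-- The definition evaluates `j` at a midpoint depending on `s`. Both that value and the one at `p'`
are reduced to the minimum of the two points, so any admissible pair `q < p'` may be used. -/
theorem gen_comp (δ : Tr.T.car n u) (hδ : ‖δ‖ ≤ 1) (hpu : p ≤ u) (x : A.M.car n p)
    {r s q p' : Pos} (hrs : r < s) (hsq : s ≤ q) (hqp : q < p') (hp' : p' < p) :
    OpenOpFamily.comp (J.gen n hpu δ x) r s hrs ((hsq.trans_lt hqp).trans hp') =
      OpFamily.comp (J.op n δ hqp (hp'.trans_le hpu) (A.M.res le_rfl hp'.le x)) r s hrs hsq := by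
  have hs := (hsq.trans_lt hqp).trans hp'
  have hm : s < min (Pos.mid s p) p' := lt_min (Pos.lt_mid hs) (hsq.trans_lt hqp)
  change OpFamily.comp (J.op n δ (Pos.lt_mid hs) ((Pos.mid_lt hs).trans_le hpu)
      (A.M.res le_rfl (Pos.mid_lt hs).le x)) r s hrs le_rfl = _
  rw [← J.op_mid_comp n δ hδ ((Pos.mid_lt hs).trans_le hpu) hrs le_rfl hm (min_le_left _ _),
    A.M.res_res]
  have h₂ := J.op_mid_comp n δ hδ (hp'.trans_le hpu) hrs hsq hqp le_rfl
    (A.M.res le_rfl hp'.le x)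
  rw [A.M.res_self] at h₂
  rw [h₂, ← J.op_mid_comp n δ hδ (hp'.trans_le hpu) hrs le_rfl hm (min_le_right _ _),
    A.M.res_res]

theorem gen_isHorizontal (δ : Tr.T.car n u) (hδ : ‖δ‖ ≤ 1) (hpu : p ≤ u) (x : A.M.car n p) :
    (J.gen n hpu δ x).IsHorizontal := by
  intro r' r s s' hr hrs hs hp y
  rw [J.gen_comp n δ hδ hpu x hrs hs (Pos.lt_mid hp) (Pos.mid_lt hp),
    J.gen_comp n δ hδ hpu x _ le_rfl (Pos.lt_mid hp) (Pos.mid_lt hp)]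
  exact (A.g_local _ (J.op_mem n δ hδ _ _ _)).1 r' r s s' hr hrs hs le_rfl y

theorem gen_agree (δ : Tr.T.car n u) (hδ : ‖δ‖ ≤ 1) (hpu : p ≤ u) (x : A.M.car n p)
    {u' p' : Pos} (hu : u' ≤ u) (hp : p' ≤ p) (hpu' : p' ≤ u') :
    OpenOpFamily.Agree hp (J.gen n hpu' (Tr.T.res le_rfl hu δ) (A.M.res le_rfl hp x))
      (J.gen n hpu δ x) := by
  intro r s hrs hs
  have hs' := Pos.mid_lt hs
  rw [J.gen_comp n δ hδ hpu x hrs le_rfl (Pos.lt_mid hs) (hs'.trans_le hp),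
    J.gen_comp n _ ((Tr.T.norm_res_le _ _ _).trans hδ) hpu' _ hrs le_rfl (Pos.lt_mid hs) hs',
    J.op_res n δ hδ, A.M.res_res]

theorem gen_smul_comp (δ : Tr.T.car n u) (hpu : p ≤ u) (c : ℂ) (x : A.M.car n p)
    {r s : Pos} (hrs : r < s) (hs : s < p) :
    OpenOpFamily.comp (J.gen n hpu δ (c • x)) r s hrs hs =
      c • OpenOpFamily.comp (J.gen n hpu δ x) r s hrs hs := by
  simp only [OpenOpFamily.comp, gen, A.M.res_smul, map_smul, OpFamily.comp]
  rfl

theorem gen_comp_f_mem (δ : Tr.T.car n u) (hδ : ‖δ‖ ≤ 1) (hpu : p ≤ u) (x : A.M.car n p)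
    {r s : Pos} (hrs : r < s) (hs : s < p) :
    OpenOpFamily.comp (J.gen n hpu δ x) r s hrs hs (A.f.val n s) ∈ A.M.car n r := by
  rw [J.gen_comp n δ hδ hpu x hrs le_rfl (Pos.lt_mid hs) (Pos.mid_lt hs)]
  exact A.act_f _ (J.op_mem n δ hδ _ _ _) _ _ _ _

theorem gen_comp_mem (δ : Tr.T.car n u) (hδ : ‖δ‖ ≤ 1) (hpu : p ≤ u) (x : A.M.car n p)
    {r s : Pos} (hrs : r < s) (hs : s < p) {y : A.E.fib n s} (hy : y ∈ A.M.car n s) :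
    OpenOpFamily.comp (J.gen n hpu δ x) r s hrs hs y ∈ A.M.car n r := by
  rw [J.gen_comp n δ hδ hpu x hrs le_rfl (Pos.lt_mid hs) (Pos.mid_lt hs)]
  exact A.act_M _ (J.op_mem n δ hδ _ _ _) _ _ _ _ _ hy

theorem pow_neg_gen_mem (δ : Tr.T.car n u) (hδ : ‖δ‖ ≤ 1) (hpu : p ≤ u) (x : A.M.car n p) (i : ℕ)
    {r : Pos} (hr : r < p) {y : A.E.fib n p} (hy : y ∈ A.M.car n p) :
    OpenOpFamily.pow (-(J.gen n hpu δ x)) i r hr y ∈ A.M.car n r := by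
  induction i generalizing r with
  | zero => exact A.M.res_mem _ _ _ hy
  | succ i ih =>
    change OpenOpFamily.comp (-(J.gen n hpu δ x)) r (Pos.mid r p) (Pos.lt_mid hr) (Pos.mid_lt hr)
      (OpenOpFamily.pow (-(J.gen n hpu δ x)) i _ _ y) ∈ _
    rw [OpenOpFamily.comp_neg]
    exact Submodule.neg_mem _ (J.gen_comp_mem n δ hδ hpu x (Pos.lt_mid hr) (Pos.mid_lt hr) (ih _))

theorem pow_succ_neg_gen_f_mem (δ : Tr.T.car n u) (hδ : ‖δ‖ ≤ 1) (hpu : p ≤ u) (x : A.M.car n p)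
    (i : ℕ) {r : Pos} (hr : r < p) :
    OpenOpFamily.pow (-(J.gen n hpu δ x)) (i + 1) r hr (A.f.val n p) ∈ A.M.car n r := by
  induction i generalizing r with
  | zero =>
    change OpenOpFamily.comp (-(J.gen n hpu δ x)) r (Pos.mid r p)
      (Pos.lt_mid hr) (Pos.mid_lt hr) (A.E.res _ _ (A.f.val n p)) ∈ _
    rw [OpenOpFamily.comp_neg, A.f.horizontal]
    exact Submodule.neg_mem _ (J.gen_comp_f_mem n δ hδ hpu x (Pos.lt_mid hr) (Pos.mid_lt hr))
  | succ i ih =>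
    change OpenOpFamily.comp (-(J.gen n hpu δ x)) r (Pos.mid r p) (Pos.lt_mid hr) (Pos.mid_lt hr)
      (OpenOpFamily.pow (-(J.gen n hpu δ x)) (i + 1) _ _ _) ∈ _
    rw [OpenOpFamily.comp_neg]
    exact Submodule.neg_mem _ (J.gen_comp_mem n δ hδ hpu x (Pos.lt_mid hr) (Pos.mid_lt hr) (ih _))

/-- Only the zeroth term of the series contains `f`; every later term lies in `M`, because the
generator maps `f` and `M` into `M`. Closedness of `M` handles the sum. -/
theorem exp_neg_gen_sub_mem (δ : Tr.T.car n u) (hδ : ‖δ‖ ≤ 1) (hpu : p ≤ u) (x : A.M.car n p)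
    {r : Pos} (hr : r < p) {y : A.E.fib n p} (hy : y ∈ A.M.car n p)
    (hs : Summable (OpenOpFamily.expTerm (-(J.gen n hpu δ x)) hr (A.f.val n p + y))) :
    OpenOpFamily.exp (-(J.gen n hpu δ x)) hr (A.f.val n p + y) - A.f.val n r ∈ A.M.car n r := by
  rw [OpenOpFamily.exp_eq_tsum, hs.tsum_eq_zero_add, OpenOpFamily.expTerm_zero, map_add,
    A.f.horizontal, add_assoc, add_sub_cancel_left]
  refine Submodule.add_mem _ (A.M.res_mem _ _ _ hy) ?_
  refine (A.M.isClosed _ _).mem_of_tendsto ((summable_nat_add_iff 1).2 hs).hasSum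
    (Eventually.of_forall fun I => Submodule.sum_mem _ fun i _ => ?_)
  rw [OpenOpFamily.expTerm, map_add]
  exact Submodule.smul_mem _ _ (Submodule.add_mem _ (J.pow_succ_neg_gen_f_mem n δ hδ hpu x i hr)
    (J.pow_neg_gen_mem n δ hδ hpu x _ hr hy))

section horizontality

variable (δ : Tr.T.car n u) (hδ : ‖δ‖ ≤ 1) (hpu : p ≤ u) (x : A.M.car n p)

theorem coe_remainder {r : Pos} (hr : r < p) :
    (J.remainder n hpu δ hδ x hr : A.E.fib n r) = A.E.res le_rfl hr.le x -
      OpenOpFamily.applyAt (J.gen n hpu δ x) hr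
        (A.f.val n p + A.E.res le_rfl hpu (δ : A.E.fib n u)) := rfl

theorem res_remainder {r' r : Pos} (hr' : r' ≤ r) (hr : r < p) :
    A.M.res le_rfl hr' (J.remainder n hpu δ hδ x hr) =
      J.remainder n hpu δ hδ x (hr'.trans_lt hr) := by
  apply Subtype.ext
  rw [A1Subspace.coe_res, coe_remainder, coe_remainder, map_sub, A.E.res_res,
    (J.gen_isHorizontal n δ hδ hpu x).res_applyAt]

theorem remainder_res {u' p' : Pos} (hu : u' ≤ u) (hp : p' ≤ p) (hpu' : p' ≤ u')
    (hδ' : ‖Tr.T.res le_rfl hu δ‖ ≤ 1) {r : Pos} (hr : r < p') :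
    J.remainder n hpu' (Tr.T.res le_rfl hu δ) hδ' (A.M.res le_rfl hp x) hr =
      J.remainder n hpu δ hδ x (hr.trans_le hp) := by
  apply Subtype.ext
  rw [coe_remainder, coe_remainder, A1Subspace.coe_res, A1Subspace.coe_res, A.E.res_res,
    ← (J.gen_agree n δ hδ hpu x hu hp hpu').applyAt_res (J.gen_isHorizontal n δ hδ hpu x) hr,
    map_add, A.f.horizontal, A.E.res_res, A.E.res_res]

theorem incr_eq {r m : Pos} (hr : r < m) (hm : m < p) :
    J.incr n hpu δ hδ x (hr.trans hm) = Tr.proj n hr (J.remainder n hpu δ hδ x hm) := by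
  have key : ∀ {m m' : Pos} (hr : r < m) (hmm : m ≤ m') (hm' : m' < p),
      Tr.proj n hr (J.remainder n hpu δ hδ x (hmm.trans_lt hm')) =
        Tr.proj n (hr.trans_le hmm) (J.remainder n hpu δ hδ x hm') := by
    intro m m' hr hmm hm'
    have := Tr.proj_horizontal (le_refl (n : ℕ∞)) le_rfl hr hmm (J.remainder n hpu δ hδ x hm')
    rw [A.M.res_self, A.M.res_self, res_remainder] at this
    exact this
  have h := hr.trans hm
  have hmin : r < min m (Pos.mid r p) := lt_min hr (Pos.lt_mid h)
  rw [incr, ← key hmin (min_le_left _ _) hm, ← key hmin (min_le_right _ _) (Pos.mid_lt h)]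

theorem res_incr {r' r : Pos} (hr' : r' ≤ r) (hr : r < p) :
    A.M.res le_rfl hr' (J.incr n hpu δ hδ x hr) = J.incr n hpu δ hδ x (hr'.trans_lt hr) := by
  rw [J.incr_eq n δ hδ hpu x (Pos.lt_mid hr) (Pos.mid_lt hr),
    J.incr_eq n δ hδ hpu x (hr'.trans_lt (Pos.lt_mid hr)) (Pos.mid_lt hr)]
  have := Tr.proj_horizontal (le_refl (n : ℕ∞)) hr' (Pos.lt_mid hr) le_rfl
    (J.remainder n hpu δ hδ x (Pos.mid_lt hr))
  rwa [A.M.res_self] at this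

theorem incr_res {u' p' : Pos} (hu : u' ≤ u) (hp : p' ≤ p) (hpu' : p' ≤ u')
    (hδ' : ‖Tr.T.res le_rfl hu δ‖ ≤ 1) {r : Pos} (hr : r < p') :
    J.incr n hpu' (Tr.T.res le_rfl hu δ) hδ' (A.M.res le_rfl hp x) hr =
      J.incr n hpu δ hδ x (hr.trans_le hp) := by
  rw [incr, J.remainder_res n δ hδ hpu x hu hp hpu',
    J.incr_eq n δ hδ hpu x (Pos.lt_mid hr) ((Pos.mid_lt hr).trans_le hp)]

theorem defect_res {u' p' : Pos} (hu : u' ≤ u) (hp : p' ≤ p) (hpu' : p' ≤ u')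
    (hδ' : ‖Tr.T.res le_rfl hu δ‖ ≤ 1) {r : Pos} (hr : r < p') :
    J.defect n hpu' (Tr.T.res le_rfl hu δ) hδ' (A.M.res le_rfl hp x) hr =
      J.defect n hpu δ hδ x (hr.trans_le hp) := by
  rw [defect, defect, J.remainder_res n δ hδ hpu x hu hp hpu', J.incr_res n δ hδ hpu x hu hp hpu']

theorem remainder_smul (c : ℂ) {r : Pos} (hr : r < p) :
    J.remainder n hpu δ hδ (c • x) hr = c • J.remainder n hpu δ hδ x hr := by
  apply Subtype.ext
  rw [Submodule.coe_smul, coe_remainder, coe_remainder, Submodule.coe_smul, map_smul, smul_sub,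
    OpenOpFamily.applyAt, gen_smul_comp]
  rfl

theorem defect_smul (c : ℂ) {r : Pos} (hr : r < p) :
    J.defect n hpu δ hδ (c • x) hr = c • J.defect n hpu δ hδ x hr := by
  rw [defect, defect, incr, incr, remainder_smul, remainder_smul, map_smul, smul_sub]

end horizontality

/-- One step of the Lie iteration, from the fibre over `(n, u)` to the fibre over `(n + 1, v)`. -/
def IsLieStep {v : Pos} (hvu : v < u) (d : Tr.T.car n u) (hd : ‖d‖ ≤ 1) (r : A.M.car n u)
    (d' : Tr.T.car (n + 1 : ℕ) v) (r' : A.M.car (n + 1 : ℕ) v) : Prop :=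
  (d' : A.E.fib (n + 1 : ℕ) v) = A.E.res (coe_le_coe_succ n) hvu.le d +
      A.E.res (coe_le_coe_succ n) le_rfl (J.incr n le_rfl d hd r hvu : A.E.fib n v) ∧
    A.f.val (n + 1 : ℕ) v + d' + r' = A.E.res (coe_le_coe_succ n) le_rfl
      (OpenOpFamily.exp (-(J.gen n le_rfl d r)) hvu (A.f.val n u + d + r))

variable {J} {n}

/-- The iteration is built over the points `P n` and read off at smaller radii. Summability at the
larger radius is what lets the restriction pass through the exponential series. -/
theorem IsLieStep.restrict {v : Pos} {hvu : v < u} {d : Tr.T.car n u} {hd : ‖d‖ ≤ 1}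
    {r : A.M.car n u} {d' : Tr.T.car (n + 1 : ℕ) v} {r' : A.M.car (n + 1 : ℕ) v}
    (h : J.IsLieStep n hvu d hd r d' r')
    (hs : Summable (OpenOpFamily.expTerm (-(J.gen n le_rfl d r)) hvu
      (A.f.val n u + (d : A.E.fib n u) + (r : A.E.fib n u))))
    {u' v' : Pos} (hu : u' ≤ u) (hv : v' ≤ v) (hvu' : v' < u')
    (hd' : ‖Tr.T.res le_rfl hu d‖ ≤ 1) :
    J.IsLieStep n hvu' (Tr.T.res le_rfl hu d) hd' (A.M.res le_rfl hu r) (Tr.T.res le_rfl hv d')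
      (A.M.res le_rfl hv r') := by
  have hU := J.gen_isHorizontal n d hd le_rfl r
  refine ⟨?_, ?_⟩
  · rw [A1Subspace.coe_res, h.1, map_add, J.incr_res n d hd le_rfl r hu hu le_rfl hd' hvu',
      ← J.res_incr n d hd le_rfl r hv hvu, A1Subspace.coe_res, A1Subspace.coe_res]
    simp only [A.E.res_res]
  · have e : A.f.val n u' + (Tr.T.res le_rfl hu d : A.E.fib n u') +
        (A.M.res le_rfl hu r : A.E.fib n u') = A.E.res le_rfl hu
          (A.f.val n u + (d : A.E.fib n u) + (r : A.E.fib n u)) := by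
      rw [map_add, map_add, A.f.horizontal]; rfl
    rw [e, (J.gen_agree n d hd le_rfl r hu hu le_rfl).neg.exp_res hU.neg hvu',
      ← hU.neg.res_exp hv hvu _ hs, A.E.res_res]
    have := congrArg (A.E.res le_rfl hv) h.2
    rw [map_add, map_add, A.f.horizontal, A.E.res_res] at this
    exact this

end LocalInverse

/-! ### Lower bounds for the weights on separated radii. -/

theorem Pos.sub_pos {a b : Pos} (h : a < b) : 0 < (b : ℝ) - a :=
  _root_.sub_pos.2 h

section weights

variable {ℓ : ℝ} {K : ℕ}

/-- On `]0, 1]` a larger exponent gives a smaller power, so an upper bound for the exponent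
suffices; negative exponents only help. -/
theorem pow_le_rpow_of_le {x e : ℝ} (hℓ : 0 < ℓ) (hx : ℓ ≤ x) (hx1 : x ≤ 1) (he : e ≤ K) :
    ℓ ^ K ≤ x ^ e := by
  calc ℓ ^ K ≤ x ^ K := by gcongr
    _ = x ^ (K : ℝ) := (Real.rpow_natCast x K).symm
    _ ≤ x ^ e := Real.rpow_le_rpow_of_exponent_ge (hℓ.trans_le hx) hx1 he

theorem pow_le_weight {α : ℝ × ℝ} (h₁ : α.1 ≤ K) (h₂ : α.2 ≤ K) (hℓ : 0 < ℓ) {s t : Pos}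
    (hs : ℓ ≤ s) (hst : (s : ℝ) + ℓ ≤ t) (ht : (t : ℝ) ≤ 1) : ℓ ^ (2 * K) ≤ weight α s t := by
  have := s.2
  rw [two_mul, pow_add]
  exact mul_le_mul (pow_le_rpow_of_le hℓ hs (by linarith) h₁)
    (pow_le_rpow_of_le hℓ (by linarith) (by linarith) h₂) (by positivity)
    (Real.rpow_nonneg this.le _)

theorem pow_le_paramWeight {α : ℝ × ℝ} (h₁ : α.1 ≤ K) (h₂ : α.2 ≤ K) (hℓ : 0 < ℓ) {t u : Pos}
    (htu : (t : ℝ) + ℓ ≤ u) (hu : (u : ℝ) ≤ 1) :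
    ℓ ^ (2 * K) ≤ paramWeight α t u := by
  have := t.2
  rw [two_mul, pow_add]
  exact mul_le_mul (pow_le_rpow_of_le hℓ (by linarith) hu h₁)
    (pow_le_rpow_of_le hℓ (by linarith) (by linarith) h₂) (by positivity)
    (Real.rpow_nonneg u.2.le _)

theorem pow_le_lam {k : ℝ} (h : k ≤ K) (hℓ : 0 < ℓ) {s t : Pos}
    (hs : ℓ ≤ s) (hst : (s : ℝ) + ℓ ≤ t) (ht : (t : ℝ) ≤ 1) : ℓ ^ (K + 1) ≤ lam k s t := by
  rw [pow_succ]
  exact mul_le_mul (pow_le_rpow_of_le hℓ hs (by linarith) h) (by linarith) hℓ.le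
    (Real.rpow_nonneg s.2.le _)

end weights

/-! ### From the suprema defining the norms of `π`, `j`, `κ` to pointwise bounds. -/

theorem norm_le_of_unit_ball {F : Type*} [NormedAddCommGroup F] [NormedSpace ℂ F] {φ : F → ℝ}
    {C : ℝ} (hφ : ∀ (c : ℂ) (x : F), φ (c • x) = ‖c‖ * φ x) (h : ∀ x, ‖x‖ ≤ 1 → φ x ≤ C) (x : F) :
    φ x ≤ C * ‖x‖ := by
  rcases eq_or_ne x 0 with rfl | hx
  · have := hφ 0 0
    simp only [smul_zero, norm_zero, zero_mul] at this
    simp [this]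
  · have hn : 0 < ‖x‖ := norm_pos_iff.2 hx
    have h₁ := h (((‖x‖⁻¹ : ℝ) : ℂ) • x) (by
      rw [norm_smul, Complex.norm_real, norm_inv, norm_norm, inv_mul_cancel₀ hn.ne'])
    rw [hφ, Complex.norm_real, norm_inv, norm_norm, inv_mul_le_iff₀ hn] at h₁
    linarith

theorem Transversal.norm_proj_le {k : ℝ} {A : ArnoldAction k} {Tr : Transversal A} {α : ℝ × ℝ}
    {S : Pos} {n : ℕ} {a : ℝ} (ha : 0 ≤ a) (h : Tr.projNorm α S n ≤ ENNReal.ofReal a) {s t : Pos}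
    (hst : s < t) (ht : t ≤ S) : weight α s t * ‖Tr.proj n hst‖ ≤ a := by
  rw [← ENNReal.ofReal_le_ofReal_iff ha]
  refine le_trans ?_ h
  exact le_iSup₂_of_le s t (le_iSup₂_of_le hst ht le_rfl)

namespace LocalInverse

variable {k : ℝ} {A : ArnoldAction k} {Tr : Transversal A} (J : LocalInverse Tr) {n : ℕ}

/-- The supremum is over the unit ball, so linearity of `j(δ)` in `x` extends the bound; the factor
`2` is `1 + ‖δ‖ ≤ 2`. -/
theorem norm_op_comp_le {β γ : ℝ × ℝ} {S : Pos} {a : ℝ} (ha : 0 ≤ a)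
    (h : J.norm β γ S n ≤ ENNReal.ofReal a) {u q p : Pos} (hu : u ≤ S) (δ : Tr.T.car n u)
    (hδ : ‖δ‖ ≤ 1) (hqp : q < p) (hpu : p < u) {r s : Pos} (hrs : r < s) (hs : s ≤ q)
    (x : A.M.car n p) :
    paramWeight β p u * weight γ q p *
      (Real.exp 1 * lam k r s * ‖OpFamily.comp (J.op n δ hqp hpu x) r s hrs hs‖) ≤
      2 * a * ‖x‖ := by
  refine norm_le_of_unit_ball (φ := fun x => paramWeight β p u * weight γ q p *
      (Real.exp 1 * lam k r s * ‖OpFamily.comp (J.op n δ hqp hpu x) r s hrs hs‖)) ?_ ?_ x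
  · intro c x
    have : OpFamily.comp (J.op n δ hqp hpu (c • x)) r s hrs hs =
        c • OpFamily.comp (J.op n δ hqp hpu x) r s hrs hs := by
      rw [map_smul]; rfl
    rw [this, norm_smul]
    ring
  · intro x hx
    have hw : 0 ≤ paramWeight β p u * weight γ q p :=
      mul_nonneg (mul_nonneg (Real.rpow_nonneg u.2.le _) (Real.rpow_nonneg (Pos.sub_pos hpu).le _))
        (mul_nonneg (Real.rpow_nonneg q.2.le _) (Real.rpow_nonneg (Pos.sub_pos hqp).le _))
    have hd : 0 < 1 + ‖δ‖ := by positivity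
    have h₁ : ENNReal.ofReal (paramWeight β p u * weight γ q p / (1 + ‖δ‖)) *
        locNorm k (J.op n δ hqp hpu x) ≤ ENNReal.ofReal a := by
      refine le_trans ?_ h
      exact le_iSup₂_of_le u hu (le_iSup₂_of_le δ hδ (le_iSup₂_of_le q p
        (le_iSup₂_of_le hqp hpu (le_iSup₂_of_le x hx le_rfl))))
    have h₂ : ENNReal.ofReal
        (Real.exp 1 * lam k r s * ‖OpFamily.comp (J.op n δ hqp hpu x) r s hrs hs‖) ≤
        locNorm k (J.op n δ hqp hpu x) :=
      le_iSup₂_of_le r s (le_iSup₂_of_le hrs hs le_rfl)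
    have h₃ := (mul_le_mul_right h₂ _).trans h₁
    rw [← ENNReal.ofReal_mul (div_nonneg hw hd.le), ENNReal.ofReal_le_ofReal_iff ha,
      div_mul_eq_mul_div, div_le_iff₀ hd] at h₃
    nlinarith

theorem norm_defect_le {ν ξ : ℝ × ℝ} {S : Pos} {a : ℝ} (ha : 0 ≤ a)
    (h : J.defectNorm ν ξ S n ≤ ENNReal.ofReal a) {u s t : Pos} (hu : u ≤ S) (δ : Tr.T.car n u)
    (hδ : ‖δ‖ ≤ 1) (hst : s < t) (htu : t < u) (x : A.M.car n t) :
    paramWeight ν t u * weight ξ s t * ((t : ℝ) / s) ^ (2 ^ n) *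
      ‖J.defect n htu.le δ hδ x hst‖ ≤ 2 * a * ‖x‖ := by
  refine norm_le_of_unit_ball (φ := fun x => paramWeight ν t u * weight ξ s t *
    ((t : ℝ) / s) ^ (2 ^ n) * ‖J.defect n htu.le δ hδ x hst‖) ?_ ?_ x
  · intro c x
    rw [defect_smul, norm_smul]
    ring
  · intro x hx
    have hd : 0 < 1 + ‖δ‖ := by positivity
    have h₁ : ENNReal.ofReal (paramWeight ν t u * weight ξ s t * ((t : ℝ) / s) ^ (2 ^ n) /
        (1 + ‖δ‖) * ‖J.defect n htu.le δ hδ x hst‖) ≤ ENNReal.ofReal a := by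
      refine le_trans ?_ h
      exact le_iSup₂_of_le u hu (le_iSup₂_of_le δ hδ (le_iSup₂_of_le s t
        (le_iSup₂_of_le hst htu (le_iSup₂_of_le x hx le_rfl))))
    rw [ENNReal.ofReal_le_ofReal_iff ha, div_mul_eq_mul_div, div_le_iff₀ hd] at h₁
    nlinarith

/-- The `n`-th norms of `π`, `j` and `κ` over `]0, 1]` are at most `a`, all exponents are at most
`K`, and the initial vector is bounded by `F`. -/
structure StepData (α β γ ν ξ : ℝ × ℝ) (K n : ℕ) (a F : ℝ) : Prop where
  one_le : 1 ≤ a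
  proj : Tr.projNorm α ⟨1, one_pos⟩ n ≤ ENNReal.ofReal a
  inv : J.norm β γ ⟨1, one_pos⟩ n ≤ ENNReal.ofReal a
  def_le : J.defectNorm ν ξ ⟨1, one_pos⟩ n ≤ ENNReal.ofReal a
  norm_f : ∀ s : Pos, (s : ℝ) ≤ 1 → ‖A.f.val n s‖ ≤ F
  k_le : k ≤ K
  α_le : α.1 ≤ K ∧ α.2 ≤ K
  β_le : β.1 ≤ K ∧ β.2 ≤ K
  γ_le : γ.1 ≤ K ∧ γ.2 ≤ K
  ν_le : ν.1 ≤ K ∧ ν.2 ≤ K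
  ξ_le : ξ.1 ≤ K ∧ ξ.2 ≤ K

/-- The constant in the estimates for one step of the Lie iteration. -/
def stepConst (K : ℕ) (a F ℓ : ℝ) : ℝ := 16 * a ^ 2 * (F + 1) / ℓ ^ (10 * K + 2)

/-! ### Estimates for one step when neighbouring radii are at least `ℓ` apart. -/

section step

variable {J} {α β γ ν ξ : ℝ × ℝ} {K : ℕ} {a F ℓ : ℝ}

theorem StepData.F_nonneg (h : J.StepData α β γ ν ξ K n a F) : 0 ≤ F :=
  (norm_nonneg _).trans (h.norm_f ⟨1, one_pos⟩ le_rfl)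

/-- One constant serves all step estimates. Its exponent is `2 * (5 * K + 1)`: `4 * K` from the
weights of `j` and `K + 1` from `λ`, doubled because the Taylor remainder is quadratic in the
generator. -/
theorem le_stepConst (ha : 1 ≤ a) (hF : 0 ≤ F) (hℓ : 0 < ℓ) (hℓ1 : ℓ ≤ 1) {c : ℝ} {N : ℕ}
    (hc : c ≤ 16 * a ^ 2 * (F + 1)) (hN : N ≤ 10 * K + 2) :
    c / ℓ ^ N ≤ stepConst K a F ℓ := by
  rw [stepConst]
  have : ℓ ^ (10 * K + 2) ≤ ℓ ^ N := pow_le_pow_of_le_one hℓ.le hℓ1 hN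
  gcongr

theorem StepData.norm_gen_comp_le (h : J.StepData α β γ ν ξ K n a F) (hℓ : 0 < ℓ) {u : Pos}
    (δ : Tr.T.car n u) (hδ : ‖δ‖ ≤ 1) (x : A.M.car n u) {q p : Pos} (hq : ℓ ≤ q)
    (hqp : (q : ℝ) + 2 * ℓ ≤ p) (hp : (p : ℝ) ≤ 1) (hpu : p ≤ u) (hqu : q < u) {r s : Pos}
    (hrs : r < s) (hs : s ≤ q) :
    Real.exp 1 * lam k r s *
      ‖OpenOpFamily.comp (J.gen n le_rfl δ x) r s hrs (hs.trans_lt hqu)‖ ≤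
      2 * a / ℓ ^ (4 * K) * ‖A.M.res le_rfl hpu x‖ := by
  have hq0 := q.2
  -- The base point `δ` is restricted to `q + 2ℓ` and `x` to `q + ℓ`. This separates the arguments
  -- of all weights by `ℓ` and keeps them below `1`, although `u` itself may exceed `1`.
  let p' : Pos := ⟨q + ℓ, by positivity⟩
  let u' : Pos := ⟨q + 2 * ℓ, by positivity⟩
  have h₁ : q < p' := by change (q : ℝ) < q + ℓ; linarith
  have h₂ : p' < u' := by change (q : ℝ) + ℓ < q + 2 * ℓ; linarith
  have h₃ : u' ≤ p := hqp
  have hu'1 : (u' : ℝ) ≤ 1 := hqp.trans hp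
  have hp'1 : (p' : ℝ) ≤ 1 := le_trans h₂.le hu'1
  have hpp : p' < u := (h₂.trans_le h₃).trans_le hpu
  rw [J.gen_comp n δ hδ le_rfl x hrs hs h₁ hpp, ← J.op_res n δ hδ h₁ h₂ (h₃.trans hpu)]
  have hop := J.norm_op_comp_le (by linarith [h.one_le]) h.inv
    (show u' ≤ ⟨1, one_pos⟩ from hu'1) (Tr.T.res le_rfl (h₃.trans hpu) δ)
    ((Tr.T.norm_res_le _ _ _).trans hδ) h₁ h₂ hrs hs (A.M.res le_rfl hpp.le x)
  have hx : ‖A.M.res le_rfl hpp.le x‖ ≤ ‖A.M.res le_rfl hpu x‖ := by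
    rw [← A.M.res_res le_rfl le_rfl hpu (h₂.le.trans h₃)]
    exact A.M.norm_res_le _ _ _
  set c := Real.exp 1 * lam k r s * ‖OpFamily.comp (J.op n (Tr.T.res le_rfl (h₃.trans hpu) δ) h₁ h₂
    (A.M.res le_rfl hpp.le x)) r s hrs hs‖
  have hc : 0 ≤ c :=
    mul_nonneg (mul_nonneg (Real.exp_pos _).le (mul_nonneg (Real.rpow_nonneg r.2.le _)
      (Pos.sub_pos hrs).le)) (norm_nonneg _)
  have w₁ := pow_le_paramWeight h.β_le.1 h.β_le.2 hℓ (t := p') (u := u')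
    (by change (q : ℝ) + ℓ + ℓ ≤ q + 2 * ℓ; linarith) hu'1
  have w₂ := pow_le_weight h.γ_le.1 h.γ_le.2 hℓ (s := q) (t := p') hq le_rfl hp'1
  have w : ℓ ^ (4 * K) ≤ paramWeight β p' u' * weight γ q p' := by
    rw [show 4 * K = 2 * K + 2 * K by ring, pow_add]
    exact mul_le_mul w₁ w₂ (by positivity) (le_trans (by positivity) w₁)
  have ha := h.one_le
  rw [div_mul_eq_mul_div, le_div_iff₀ (by positivity), mul_comm]
  calc ℓ ^ (4 * K) * c ≤ paramWeight β p' u' * weight γ q p' * c := by gcongr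
    _ ≤ 2 * a * ‖A.M.res le_rfl hpp.le x‖ := hop
    _ ≤ _ := by gcongr

theorem StepData.norm_incr_le (h : J.StepData α β γ ν ξ K n a F) (hℓ : 0 < ℓ) {u : Pos}
    (δ : Tr.T.car n u) (hδ : ‖δ‖ ≤ 1) (x : A.M.car n u) {s p : Pos} (hs : ℓ ≤ s)
    (hsp : (s : ℝ) + 4 * ℓ ≤ p) (hp : (p : ℝ) ≤ 1) (hpu : p ≤ u) (hsu : s < u) :
    ‖J.incr n le_rfl δ hδ x hsu‖ ≤ stepConst K a F ℓ * ‖A.M.res le_rfl hpu x‖ := by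
  have hs0 := s.2
  have ha := h.one_le
  have hF := h.F_nonneg
  have hℓ1 : ℓ ≤ 1 := by linarith
  set X := ‖A.M.res le_rfl hpu x‖ with hX
  have hX0 : 0 ≤ X := norm_nonneg _
  -- Here `π` acts from `m` to `s` and the generator from `q` to `m`; the remaining `2ℓ` up to `p`
  -- is needed to bound the generator.
  let m : Pos := ⟨s + ℓ, by positivity⟩
  let q : Pos := ⟨s + 2 * ℓ, by positivity⟩
  have hsm : s < m := by change (s : ℝ) < s + ℓ; linarith
  have hmq : m < q := by change (s : ℝ) + ℓ < s + 2 * ℓ; linarith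
  have hqp : q < p := by change (s : ℝ) + 2 * ℓ < p; linarith
  have hq1 : (q : ℝ) ≤ 1 := le_trans hqp.le hp
  have hm1 : (m : ℝ) ≤ 1 := le_trans hmq.le hq1
  have hqu := hqp.trans_le hpu
  have hmu := hmq.trans hqu
  have hg := h.norm_gen_comp_le hℓ δ hδ x (q := q) (p := p)
    (by change ℓ ≤ s + 2 * ℓ; linarith) (by change (s : ℝ) + 2 * ℓ + 2 * ℓ ≤ p; linarith) hp hpu
    hqu hmq le_rfl
  have hl := pow_le_lam h.k_le hℓ (s := m) (t := q) (by change ℓ ≤ s + ℓ; linarith)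
    (by change (s : ℝ) + ℓ + ℓ ≤ s + 2 * ℓ; linarith) hq1
  set c := ‖OpenOpFamily.comp (J.gen n le_rfl δ x) m q hmq hqu‖ with hc
  have hcle : c ≤ 2 * a / ℓ ^ (5 * K + 1) * X := by
    have h₁ : ℓ ^ (K + 1) * c ≤ 2 * a / ℓ ^ (4 * K) * X := by
      refine le_trans ?_ hg
      have h₃ : (1 : ℝ) ≤ Real.exp 1 := Real.one_le_exp zero_le_one
      have h₂ : ℓ ^ (K + 1) ≤ Real.exp 1 * lam k m q :=
        hl.trans (le_mul_of_one_le_left (le_trans (by positivity) hl) h₃)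
      gcongr
    rw [show 5 * K + 1 = 4 * K + (K + 1) by ring, pow_add, div_mul_eq_mul_div,
      le_div_iff₀ (by positivity)]
    rw [div_mul_eq_mul_div, le_div_iff₀ (by positivity)] at h₁
    linarith
  have hrem : ‖J.remainder n le_rfl δ hδ x hmu‖ ≤ X + 2 * a / ℓ ^ (5 * K + 1) * X * (F + 1) := by
    change ‖(J.remainder n le_rfl δ hδ x hmu : A.E.fib n m)‖ ≤ _
    rw [coe_remainder]
    refine (norm_sub_le _ _).trans (add_le_add ?_ ?_)
    · rw [← A.E.res_res le_rfl le_rfl hpu (hmq.le.trans hqp.le)]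
      exact A.E.norm_res_le _ _ _
    · rw [(J.gen_isHorizontal n δ hδ le_rfl x).applyAt_eq hmq hqu]
      refine (ContinuousLinearMap.le_opNorm _ _).trans (mul_le_mul hcle ?_ (norm_nonneg _)
        (by positivity))
      rw [map_add, A.f.horizontal]
      refine (norm_add_le _ _).trans (add_le_add (h.norm_f q hq1) ?_)
      rw [A.E.res_res]
      exact (A.E.norm_res_le _ _ _).trans hδ
  have hπ := Transversal.norm_proj_le (by linarith) h.proj hsm
    (show m ≤ ⟨1, one_pos⟩ from hm1)
  have hπw := pow_le_weight h.α_le.1 h.α_le.2 hℓ (s := s) (t := m) hs le_rfl hm1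
  have hπ' : ‖Tr.proj n hsm‖ ≤ a / ℓ ^ (2 * K) := by
    rw [le_div_iff₀ (by positivity), mul_comm]
    refine le_trans ?_ hπ
    gcongr
  rw [J.incr_eq n δ hδ le_rfl x hsm hmu]
  refine (ContinuousLinearMap.le_opNorm _ _).trans ?_
  have hp1 : ℓ ^ (5 * K + 1) ≤ 1 := pow_le_one₀ hℓ.le hℓ1
  calc _ ≤ a / ℓ ^ (2 * K) * (X + 2 * a / ℓ ^ (5 * K + 1) * X * (F + 1)) := by gcongr
    _ ≤ a / ℓ ^ (2 * K) * (1 / ℓ ^ (5 * K + 1) * X * (a * (F + 1)) +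
          2 * a / ℓ ^ (5 * K + 1) * X * (F + 1)) := by
        gcongr
        have h₁ : 1 ≤ 1 / ℓ ^ (5 * K + 1) := by rw [le_div_iff₀ (by positivity)]; linarith
        have h₂ : 1 ≤ a * (F + 1) := by nlinarith
        calc X ≤ 1 * X * 1 := by linarith
          _ ≤ _ := by gcongr
    _ = (3 * a ^ 2 * (F + 1)) / ℓ ^ (7 * K + 1) * X := by
        rw [show 7 * K + 1 = 2 * K + (5 * K + 1) by ring, pow_add]; field_simp; ring
    _ ≤ _ := by
        gcongr
        refine le_stepConst ha hF hℓ hℓ1 ?_ (by omega)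
        gcongr
        norm_num

theorem StepData.norm_defect_le (h : J.StepData α β γ ν ξ K n a F) (hℓ : 0 < ℓ) {u : Pos}
    (δ : Tr.T.car n u) (hδ : ‖δ‖ ≤ 1) (x : A.M.car n u) {s t p : Pos} (hs : ℓ ≤ s)
    (hst : (s : ℝ) + ℓ ≤ t) (htp : (t : ℝ) + ℓ ≤ p) (hp : (p : ℝ) ≤ 1) (hpu : p ≤ u) (htu : t ≤ u)
    (hsu : s < u) :
    ‖J.defect n le_rfl δ hδ x hsu‖ ≤
      stepConst K a F ℓ * ((s : ℝ) / t) ^ (2 ^ n) * ‖A.M.res le_rfl htu x‖ := by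
  have hs0 := s.2
  have ht0 := t.2
  have ha := h.one_le
  have hF := h.F_nonneg
  have hst' : s < t := by change (s : ℝ) < t; linarith
  have htp' : t < p := by change (t : ℝ) < p; linarith
  rw [← J.defect_res n δ hδ le_rfl x hpu htu htp'.le ((Tr.T.norm_res_le _ _ _).trans hδ) hst']
  have h₁ := J.norm_defect_le (by linarith) h.def_le (show p ≤ ⟨1, one_pos⟩ from hp)
    (Tr.T.res le_rfl hpu δ) ((Tr.T.norm_res_le _ _ _).trans hδ) hst' htp' (A.M.res le_rfl htu x)
  set c := ‖J.defect n htp'.le (Tr.T.res le_rfl hpu δ) ((Tr.T.norm_res_le _ _ _).trans hδ)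
    (A.M.res le_rfl htu x) hst'‖
  have w₁ := pow_le_paramWeight h.ν_le.1 h.ν_le.2 hℓ htp hp
  have w₂ := pow_le_weight h.ξ_le.1 h.ξ_le.2 hℓ hs hst (by linarith)
  have w : ℓ ^ (4 * K) ≤ paramWeight ν t p * weight ξ s t := by
    rw [show 4 * K = 2 * K + 2 * K by ring, pow_add]
    exact mul_le_mul w₁ w₂ (by positivity) (le_trans (by positivity) w₁)
  have h₂ : ℓ ^ (4 * K) * ((t : ℝ) / s) ^ (2 ^ n) * c ≤ 2 * a * ‖A.M.res le_rfl htu x‖ := by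
    refine le_trans ?_ h₁
    gcongr
  have h₃ : c ≤ 2 * a / ℓ ^ (4 * K) * ((s : ℝ) / t) ^ (2 ^ n) * ‖A.M.res le_rfl htu x‖ := by
    have e : ((t : ℝ) / s) ^ (2 ^ n) = (((s : ℝ) / t) ^ (2 ^ n))⁻¹ := by
      rw [← inv_pow, inv_div]
    have e0 : 0 < ((s : ℝ) / t) ^ (2 ^ n) := by positivity
    rw [e] at h₂
    rw [div_mul_eq_mul_div, div_mul_eq_mul_div, le_div_iff₀ (by positivity)]
    have := mul_le_mul_of_nonneg_left h₂ e0.le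
    calc c * ℓ ^ (4 * K) = ((s : ℝ) / t) ^ (2 ^ n) *
          (ℓ ^ (4 * K) * (((s : ℝ) / t) ^ (2 ^ n))⁻¹ * c) := by field_simp
      _ ≤ _ := this
      _ = _ := by ring
  refine h₃.trans ?_
  gcongr
  refine le_stepConst ha hF hℓ (by linarith) ?_ (by omega)
  nlinarith [mul_nonneg (sq_nonneg a) hF]

/-- The ratio `C / λ(s,q)` is the expansion parameter of the exponential, and it is linear in `‖x‖`.
This serves both the well-definedness of the iteration and the quadratic error. -/
theorem StepData.exists_locNorm_le (h : J.StepData α β γ ν ξ K n a F) (hℓ : 0 < ℓ) {u : Pos}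
    (δ : Tr.T.car n u) (hδ : ‖δ‖ ≤ 1) (x : A.M.car n u) {s p : Pos} (hs : ℓ ≤ s)
    (hsp : (s : ℝ) + 4 * ℓ ≤ p) (hp : (p : ℝ) ≤ 1) (hpu : p ≤ u) :
    ∃ (q : Pos) (C : ℝ) (_ : s < q) (hqu : q < u),
      (∀ (r s : Pos) (hrs : r < s) (hs : s ≤ q), Real.exp 1 * lam k r s *
        ‖OpenOpFamily.comp (J.gen n le_rfl δ x) r s hrs (hs.trans_lt hqu)‖ ≤ C) ∧
      C / lam k s q ≤ 2 * a / ℓ ^ (5 * K + 1) * ‖A.M.res le_rfl hpu x‖ := by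
  have hs0 := s.2
  have ha := h.one_le
  let q : Pos := ⟨s + ℓ, by positivity⟩
  have hsq : s < q := by change (s : ℝ) < s + ℓ; linarith
  have hqp : q < p := by change (s : ℝ) + ℓ < p; linarith
  have hq1 : (q : ℝ) ≤ 1 := le_trans hqp.le hp
  have hq₁ : ℓ ≤ (q : ℝ) := by change ℓ ≤ s + ℓ; linarith
  have hq₂ : (q : ℝ) + 2 * ℓ ≤ p := by change (s : ℝ) + ℓ + 2 * ℓ ≤ p; linarith
  refine ⟨q, 2 * a / ℓ ^ (4 * K) * ‖A.M.res le_rfl hpu x‖, hsq, hqp.trans_le hpu,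
    fun r s hrs hs => h.norm_gen_comp_le hℓ δ hδ x hq₁ hq₂ hp hpu
      (hqp.trans_le hpu) hrs hs, ?_⟩
  have hl := pow_le_lam h.k_le hℓ hs (t := q) le_rfl hq1
  calc _ ≤ 2 * a / ℓ ^ (4 * K) * ‖A.M.res le_rfl hpu x‖ / ℓ ^ (K + 1) := by gcongr
    _ = _ := by
      rw [show 5 * K + 1 = 4 * K + (K + 1) by ring, pow_add]; field_simp; ring

theorem StepData.exists_locNorm_lt (h : J.StepData α β γ ν ξ K n a F) (hℓ : 0 < ℓ) {u : Pos}
    (δ : Tr.T.car n u) (hδ : ‖δ‖ ≤ 1) (x : A.M.car n u) {s p : Pos} (hs : ℓ ≤ s)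
    (hsp : (s : ℝ) + 4 * ℓ ≤ p) (hp : (p : ℝ) ≤ 1) (hpu : p ≤ u)
    (hsmall : stepConst K a F ℓ * ‖A.M.res le_rfl hpu x‖ ≤ 1 / 2) :
    ∃ (q : Pos) (hq : q < u), s < q ∧
      locNorm k (OpenOpFamily.restrict hq (J.gen n le_rfl δ x)) < ENNReal.ofReal (lam k s q) := by
  obtain ⟨q, C, hsq, hqu, hC, hy⟩ := h.exists_locNorm_le hℓ δ hδ x hs hsp hp hpu
  have hs0 := s.2
  have ha := h.one_le
  have hF := h.F_nonneg
  have hl : 0 < lam k s q := mul_pos (Real.rpow_pos_of_pos s.2 k) (Pos.sub_pos hsq)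
  have hlt : C < lam k s q := by
    have h₁ : 2 * a / ℓ ^ (5 * K + 1) ≤ stepConst K a F ℓ := by
      refine le_stepConst ha hF hℓ (by linarith) ?_ (by omega)
      nlinarith [mul_nonneg (sq_nonneg a) hF]
    have h₂ : C / lam k s q ≤ 1 / 2 :=
      hy.trans ((mul_le_mul_of_nonneg_right h₁ (norm_nonneg _)).trans hsmall)
    rw [div_le_iff₀ hl] at h₂
    linarith
  refine ⟨q, hqu, hsq, lt_of_le_of_lt ?_ ((ENNReal.ofReal_lt_ofReal_iff hl).2 hlt)⟩
  exact iSup₂_le fun r s => iSup₂_le fun hrs hs => ENNReal.ofReal_le_ofReal (hC r s hrs hs)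

/-- With `w = f + δ` and generator `u = j(δ)(x)`, one has `e^{-u}(w + x) = w + (x - u w) + …`. As
`u` is linear in `x`, the omitted terms `u² w`, `u x` and beyond are of second order, while `w` is
bounded by `F + 1`. All is computed after restriction to `p`, so that only the norm of `x` over `p`
enters. -/
theorem StepData.exp_estimate (hk : 0 < k) (h : J.StepData α β γ ν ξ K n a F) (hℓ : 0 < ℓ) {u : Pos}
    (δ : Tr.T.car n u) (hδ : ‖δ‖ ≤ 1) (x : A.M.car n u) {s p : Pos} (hs : ℓ ≤ s)
    (hsp : (s : ℝ) + 4 * ℓ ≤ p) (hp : (p : ℝ) ≤ 1) (hpu : p ≤ u) (hsu : s < u)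
    (hsmall : stepConst K a F ℓ * ‖A.M.res le_rfl hpu x‖ ≤ 1 / 2) :
    Summable (OpenOpFamily.expTerm (-(J.gen n le_rfl δ x)) hsu
      (A.f.val n u + (δ : A.E.fib n u) + (x : A.E.fib n u))) ∧
    ‖OpenOpFamily.exp (-(J.gen n le_rfl δ x)) hsu
        (A.f.val n u + (δ : A.E.fib n u) + (x : A.E.fib n u)) -
      A.E.res le_rfl hsu.le (A.f.val n u + (δ : A.E.fib n u)) -
      (J.remainder n le_rfl δ hδ x hsu : A.E.fib n s)‖ ≤
      stepConst K a F ℓ * ‖A.M.res le_rfl hpu x‖ ^ 2 := by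
  have hs0 := s.2
  have ha := h.one_le
  have hF := h.F_nonneg
  have hℓ1 : ℓ ≤ 1 := by linarith
  set X := ‖A.M.res le_rfl hpu x‖ with hX
  have hX0 : 0 ≤ X := norm_nonneg _
  have hsp' : s < p := by change (s : ℝ) < p; linarith
  set δ' := Tr.T.res le_rfl hpu δ with hδ'
  set x' := A.M.res le_rfl hpu x with hx'
  have hδ'1 : ‖δ'‖ ≤ 1 := (Tr.T.norm_res_le _ _ _).trans hδ
  have hU := J.gen_isHorizontal n δ hδ le_rfl x
  have hU' := J.gen_isHorizontal n δ' hδ'1 le_rfl x'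
  have hag := J.gen_agree n δ hδ le_rfl x hpu hpu le_rfl
  obtain ⟨q, C, hsq, hqp, hC, hy⟩ :=
    h.exists_locNorm_le hℓ δ' hδ'1 x' hs hsp hp le_rfl
  rw [A.M.res_self] at hy
  have hCneg : ∀ (r s : Pos) (hrs : r < s) (hs : s ≤ q), Real.exp 1 * lam k r s *
        ‖OpenOpFamily.comp (-(J.gen n le_rfl δ' x')) r s hrs (hs.trans_lt hqp)‖ ≤ C := by
    intro r s hrs hs
    have := hC r s hrs hs
    rwa [← norm_neg] at this
  have h₁ : 2 * a / ℓ ^ (5 * K + 1) ≤ stepConst K a F ℓ := by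
    refine le_stepConst ha hF hℓ hℓ1 ?_ (by omega)
    nlinarith [mul_nonneg (sq_nonneg a) hF]
  have hl : 0 < lam k s q := mul_pos (Real.rpow_pos_of_pos s.2 k) (Pos.sub_pos hsq)
  have hC0 : 0 ≤ C := le_trans (mul_nonneg (mul_nonneg (Real.exp_pos _).le hl.le) (norm_nonneg _))
    (hC s q hsq le_rfl)
  have hy0 : 0 ≤ C / lam k s q := div_nonneg hC0 hl.le
  have hyh : C / lam k s q ≤ 1 / 2 :=
    hy.trans ((mul_le_mul_of_nonneg_right h₁ hX0).trans hsmall)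
  have ew : A.E.res le_rfl hpu (A.f.val n u + (δ : A.E.fib n u)) =
      A.f.val n p + (δ' : A.E.fib n p) := by
    rw [map_add, A.f.horizontal]; rfl
  have ewx : A.E.res le_rfl hpu (A.f.val n u + (δ : A.E.fib n u) + (x : A.E.fib n u)) =
      A.f.val n p + (δ' : A.E.fib n p) + (x' : A.E.fib n p) := by
    rw [map_add, ew]; rfl
  have hterm : OpenOpFamily.expTerm (-(J.gen n le_rfl δ x)) hsu
      (A.f.val n u + (δ : A.E.fib n u) + (x : A.E.fib n u)) =
      OpenOpFamily.expTerm (-(J.gen n le_rfl δ' x')) hsp'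
        (A.f.val n p + (δ' : A.E.fib n p) + (x' : A.E.fib n p)) := by
    funext i
    rw [OpenOpFamily.expTerm, OpenOpFamily.expTerm, ← ewx, hag.neg.pow_res hU.neg]
  refine ⟨?_, ?_⟩
  · rw [hterm]
    exact OpenOpFamily.summable_of_geometric hy0 hyh
      (hU'.neg.norm_expTerm_le hk hsq hqp hCneg _)
  · have hexp : OpenOpFamily.exp (-(J.gen n le_rfl δ x)) hsu
        (A.f.val n u + (δ : A.E.fib n u) + (x : A.E.fib n u)) =
        OpenOpFamily.exp (-(J.gen n le_rfl δ' x')) hsp'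
        (A.f.val n p + (δ' : A.E.fib n p) + (x' : A.E.fib n p)) := by
      rw [OpenOpFamily.exp_eq_tsum, hterm, ← OpenOpFamily.exp_eq_tsum]
    have hres : A.E.res le_rfl hsu.le (A.f.val n u + (δ : A.E.fib n u)) =
        A.E.res le_rfl hsp'.le (A.f.val n p + (δ' : A.E.fib n p)) := by
      rw [← ew, A.E.res_res]
    have hrem : (J.remainder n le_rfl δ hδ x hsu : A.E.fib n s) =
        A.E.res le_rfl hsp'.le (x' : A.E.fib n p) -
          OpenOpFamily.applyAt (J.gen n le_rfl δ' x') hsp'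
            (A.f.val n p + (δ' : A.E.fib n p)) := by
      rw [← J.remainder_res n δ hδ le_rfl x hpu hpu le_rfl hδ'1 hsp', coe_remainder, A.E.res_self]
    rw [hexp, hres, hrem]
    have hest := hU'.neg.norm_exp_sub_le hk hsq hqp hCneg hyh
      (A.f.val n p + (δ' : A.E.fib n p)) (x' : A.E.fib n p)
    have hneg : OpenOpFamily.applyAt (-(J.gen n le_rfl δ' x')) (hsq.trans hqp)
        (A.f.val n p + (δ' : A.E.fib n p)) = -OpenOpFamily.applyAt (J.gen n le_rfl δ' x') hsp'
        (A.f.val n p + (δ' : A.E.fib n p)) := rfl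
    rw [hneg] at hest
    have hwn : ‖A.f.val n p + (δ' : A.E.fib n p)‖ ≤ F + 1 :=
      (norm_add_le _ _).trans (add_le_add (h.norm_f p hp) hδ'1)
    have hxn : ‖(x' : A.E.fib n p)‖ = X := rfl
    rw [map_add _ _ (x' : A.E.fib n p)] at hest
    calc _ ≤ _ := le_trans (le_of_eq (by congr 1; abel)) hest
      _ ≤ 2 * (2 * a / ℓ ^ (5 * K + 1) * X) ^ 2 * (F + 1) +
          2 * (2 * a / ℓ ^ (5 * K + 1) * X) * X := by
        rw [hxn]; gcongr
      _ = (8 * a ^ 2 * (F + 1) / ℓ ^ (10 * K + 2) + 4 * a / ℓ ^ (5 * K + 1)) * X ^ 2 := by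
        rw [show 10 * K + 2 = (5 * K + 1) * 2 by ring, pow_mul]; field_simp; ring
      _ ≤ (8 * a ^ 2 * (F + 1) / ℓ ^ (10 * K + 2) + 4 * a ^ 2 * (F + 1) / ℓ ^ (10 * K + 2)) *
          X ^ 2 := by
        have : ℓ ^ (10 * K + 2) ≤ ℓ ^ (5 * K + 1) := pow_le_pow_of_le_one hℓ.le hℓ1 (by omega)
        have : 4 * a ≤ 4 * a ^ 2 * (F + 1) := by nlinarith [mul_nonneg (sq_nonneg a) hF]
        gcongr
      _ ≤ _ := by
        rw [stepConst, ← add_div]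
        have : 0 ≤ a ^ 2 * (F + 1) := by positivity
        gcongr
        linarith

end step

end LocalInverse

/-! ### Radial profiles and schedules of radii. -/

/-- The order of vanishing `2^(n-1)` (and `0` for `n = 0`) of the `n`-th radial profile. -/
def profileOrder (n : ℕ) : ℕ := 2 ^ n / 2

theorem profileOrder_zero : profileOrder 0 = 0 := rfl

theorem profileOrder_succ (n : ℕ) : profileOrder (n + 1) = 2 ^ n := by
  simp [profileOrder, pow_succ]

theorem profileOrder_le (n : ℕ) : profileOrder n ≤ 2 ^ n := Nat.div_le_self _ _

theorem two_mul_profileOrder {n : ℕ} (h : 1 ≤ n) : 2 * profileOrder n = 2 ^ n := by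
  obtain ⟨n, rfl⟩ := Nat.exists_eq_add_of_le' h
  rw [profileOrder_succ, pow_succ]; ring

/-- The ratio `2^(1/2^n)` of neighbouring radii at the `n`-th step. -/
def stepRatio (n : ℕ) : ℝ := Real.exp (Real.log 2 / 2 ^ n)

theorem stepRatio_pos (n : ℕ) : 0 < stepRatio n := Real.exp_pos _

theorem stepRatio_pow (n : ℕ) : stepRatio n ^ (2 ^ n) = 2 := by
  rw [stepRatio, ← Real.exp_nat_mul]
  push_cast
  rw [mul_div_cancel₀ _ (by positivity), Real.exp_log two_pos]

theorem le_stepRatio (n : ℕ) : 1 + 1 / (2 * 2 ^ n) ≤ stepRatio n := by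
  have h₁ := Real.add_one_le_exp (Real.log 2 / 2 ^ n)
  have h₂ : (1 : ℝ) / (2 * 2 ^ n) ≤ Real.log 2 / 2 ^ n := by
    rw [← div_div]
    have := Real.log_two_gt_d9
    gcongr
    linarith
  rw [stepRatio]
  linarith

theorem one_lt_stepRatio (n : ℕ) : 1 < stepRatio n := by
  have := le_stepRatio n
  have : (0 : ℝ) < 1 / (2 * 2 ^ n) := by positivity
  linarith

/-- The separation of the radii used in the `n`-th step. -/
def stepGap (L : ℝ) (n : ℕ) : ℝ := L / (8 * 2 ^ n)

theorem stepGap_pos {L : ℝ} (hL : 0 < L) (n : ℕ) : 0 < stepGap L n := by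
  rw [stepGap]; positivity

theorem stepGap_le {L : ℝ} (hL : 0 < L) (n : ℕ) : stepGap L n ≤ L := by
  rw [stepGap]
  have : (1 : ℝ) ≤ 2 ^ n := one_le_pow₀ one_le_two
  exact div_le_self hL.le (by linarith)

/-- This fixes the normalization of `stepGap`: passing from `s` to `stepRatio n * s` gains at least
`s / (2 * 2^n)`, room for four gaps. -/
theorem add_stepGap_le {L s : ℝ} (hL : 0 < L) (hs : L ≤ s) (n : ℕ) :
    s + 4 * stepGap L n ≤ stepRatio n * s := by
  have h := le_stepRatio n
  have hs0 : 0 ≤ s := hL.le.trans hs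
  have h₁ : (1 + 1 / (2 * 2 ^ n)) * s ≤ stepRatio n * s := by gcongr
  have h₂ : 4 * stepGap L n ≤ 1 / (2 * 2 ^ n) * s := by
    rw [stepGap]
    calc 4 * (L / (8 * 2 ^ n)) = 1 / (2 * 2 ^ n) * L := by field_simp; norm_num
      _ ≤ _ := by gcongr
  linarith

/-- The radii `P n`, the lower end `L` of the range of radii, and the amplitudes `G n` of the radial
profiles `G n * (s / P n) ^ profileOrder n`, for the estimates with constants `B n / L ^ N`.
The first `n₀` steps are not contracting; the amplitudes make up for it. -/
structure IsSchedule (N n₀ : ℕ) (B : ℕ → ℝ) (L : ℝ) (P G : ℕ → ℝ) : Prop where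
  one_le_n₀ : 1 ≤ n₀
  one_le_B : ∀ n, 1 ≤ B n
  L_pos : 0 < L
  two_L_le : ∀ n, 2 * L ≤ P n
  P_le : ∀ n, P n ≤ 1
  ratio_le : ∀ n, (P (n + 1) / P n) ^ 2 ^ n ≤ 1 / 4
  G_pos : ∀ n, 0 < G n
  G_le : ∀ n, G n ≤ 1
  amplify : ∀ n < n₀, B n / L ^ N * 2 ^ (n + 2) * G n ≤ G (n + 1) * L ^ (2 ^ n)
  G_eq : ∀ n, n₀ ≤ n → G n = 1
  contract : ∀ n, n₀ ≤ n → (P (n + 1) / P n) ^ 2 ^ n ≤ 1 / (B n / L ^ N * 2 ^ (n + 3)) ^ 2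

/-! ### The inequalities by which profiles reproduce themselves. -/

namespace IsSchedule

variable {N n₀ : ℕ} {B : ℕ → ℝ} {L : ℝ} {P G : ℕ → ℝ} (h : IsSchedule N n₀ B L P G)
include h

theorem L_le_one : L ≤ 1 := by linarith [h.two_L_le 0, h.P_le 0, h.L_pos]

theorem P_pos (n : ℕ) : 0 < P n := by linarith [h.two_L_le n, h.L_pos]

theorem const_pos (n : ℕ) : 1 ≤ B n / L ^ N := by
  have := h.L_pos
  rw [le_div_iff₀ (by positivity), one_mul]
  exact (pow_le_one₀ h.L_pos.le h.L_le_one).trans (h.one_le_B n)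

/-- Since `stepRatio n ^ (2^n) = 2`, the bound `1/4` on the radius ratio leaves room for two
enlargements: from `s` up to `stepRatio n * s`, and from `P n / stepRatio n` up to `P n`. -/
theorem ratio_sq_mul_le (n : ℕ) : stepRatio n ^ 2 * P (n + 1) ≤ P n := by
  have h₀ := h.P_pos n
  have h₁ := h.P_pos (n + 1)
  have h₂ := stepRatio_pos n
  have h₃ : (stepRatio n ^ 2 * (P (n + 1) / P n)) ^ 2 ^ n ≤ 1 := by
    rw [mul_pow, ← pow_mul, mul_comm 2, pow_mul, stepRatio_pow]
    linarith [h.ratio_le n]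
  have h₄ : stepRatio n ^ 2 * (P (n + 1) / P n) ≤ 1 :=
    (pow_le_one_iff_of_nonneg (by positivity) (by positivity)).1 h₃
  rwa [← mul_div_assoc, div_le_one h₀] at h₄

theorem ratio_mul_lt (n : ℕ) : stepRatio n * P (n + 1) < P n := by
  have h₁ := h.ratio_sq_mul_le n
  have h₂ := one_lt_stepRatio n
  have h₃ := h.P_pos (n + 1)
  nlinarith [mul_pos (stepRatio_pos n) h₃]

theorem P_succ_lt (n : ℕ) : P (n + 1) < P n := by
  have h₁ := h.ratio_mul_lt n
  have h₂ := one_lt_stepRatio n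
  have h₃ := h.P_pos (n + 1)
  nlinarith

theorem L_pow_le {s : ℝ} (hs : L ≤ s) {n e E : ℕ} (he : e ≤ E) :
    L ^ E ≤ (s / P n) ^ e := by
  have h₀ := h.L_pos
  have h₁ : L ≤ s / P n := by
    rw [le_div_iff₀ (h.P_pos n)]
    nlinarith [h.P_le n]
  calc L ^ E ≤ L ^ e := pow_le_pow_of_le_one h₀.le h.L_le_one he
    _ ≤ _ := by gcongr

/-- Controls the normal form increment and the size of the generator. For `n ≥ n₀` the square in
`contract` is spent here: the profile has order `2^(n-1)`, so only the square root of `(P (n+1) / P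
n)^(2^n)` is available against the constant. For `n < n₀` the old profile is bounded by its
amplitude, the new power is at least `L^(2^n)`, and `amplify` compares the two. -/
theorem linear_estimate {H s : ℝ} (hH : 0 ≤ H) (n : ℕ) (hs : L ≤ s) (hsP : s ≤ P (n + 1)) :
    B n / L ^ N * (H * (G n * (stepRatio n * s / P n) ^ profileOrder n)) ≤
      H * (1 / 2) ^ (n + 2) * (s / P (n + 1)) ^ profileOrder n := by
  have hL := h.L_pos
  have hA := h.const_pos n
  have h₀ := h.P_pos n
  have h₁ := h.P_pos (n + 1)
  have hρ := stepRatio_pos n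
  have hG := h.G_pos n
  have hG' := h.G_le (n + 1)
  have hs0 : 0 < s := hL.trans_le hs
  have hle : stepRatio n * s / P n ≤ 1 := by
    rw [div_le_one h₀]
    exact le_trans (by gcongr) (h.ratio_mul_lt n).le
  set A := B n / L ^ N
  rcases lt_or_ge n n₀ with hn | hn
  · have ha := h.amplify n hn
    have h₂ : (stepRatio n * s / P n) ^ profileOrder n ≤ 1 := pow_le_one₀ (by positivity) hle
    have h₃ := h.L_pow_le hs (n := n + 1) (profileOrder_le n)
    have h₄ : A * G n ≤ (1 / 2) ^ (n + 2) * (s / P (n + 1)) ^ profileOrder n := by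
      rw [one_div_pow, one_div_mul_eq_div, le_div_iff₀ (by positivity)]
      calc A * G n * 2 ^ (n + 2) = A * 2 ^ (n + 2) * G n := by ring
        _ ≤ G (n + 1) * L ^ 2 ^ n := ha
        _ ≤ 1 * (s / P (n + 1)) ^ profileOrder n := by gcongr
        _ = _ := one_mul _
    calc _ ≤ A * (H * (G n * 1)) := by gcongr
      _ = H * (A * G n) := by ring
      _ ≤ H * ((1 / 2) ^ (n + 2) * (s / P (n + 1)) ^ profileOrder n) := by gcongr
      _ = _ := by ring
  · rw [h.G_eq n hn, one_mul]
    have hc := h.contract n hn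
    set θ := P (n + 1) / P n with hθ
    have hθ0 : 0 < θ := by positivity
    have e₁ : stepRatio n * s / P n = stepRatio n * θ * (s / P (n + 1)) := by
      rw [hθ]; field_simp
    have h₂ : (stepRatio n * θ) ^ profileOrder n ≤ 2 / (A * 2 ^ (n + 3)) := by
      refine (pow_le_pow_iff_left₀ (by positivity) (by positivity) two_ne_zero).1 ?_
      rw [← pow_mul, mul_comm _ 2, two_mul_profileOrder (h.one_le_n₀.trans hn), mul_pow,
        stepRatio_pow]
      calc 2 * θ ^ 2 ^ n ≤ 2 * (1 / (A * 2 ^ (n + 3)) ^ 2) := by gcongr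
        _ = 2 / (A * 2 ^ (n + 3)) ^ 2 := by ring
        _ ≤ (2 / (A * 2 ^ (n + 3))) ^ 2 := by rw [div_pow 2]; gcongr; norm_num
    rw [e₁, mul_pow]
    calc _ ≤ A * (H * (2 / (A * 2 ^ (n + 3)) * (s / P (n + 1)) ^ profileOrder n)) := by gcongr
      _ = _ := by
        have : A ≠ 0 := by positivity
        rw [pow_succ _ (n + 2), one_div_pow]; field_simp

/-- The first summand is the cutoff defect, measured from `P n / stepRatio n`; the second is the
Taylor remainder. For `n ≥ n₀` both are bounded by `H * A * x^(2^n)` with `x = stepRatio n * s / P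
n` and `A = B n / L ^ N`, and `x^(2^n)` is twice `(P (n+1) / P n)^(2^n)` times the new profile.
Hence `4 * A * (P (n+1) / P n)^(2^n) ≤ 1` suffices. -/
theorem quadratic_estimate {H s : ℝ} (hH : 0 ≤ H) (hH1 : H ≤ 1) (n : ℕ) (hs : L ≤ s)
    (hsP : s ≤ P (n + 1)) :
    B n / L ^ N * (s / (P n / stepRatio n)) ^ 2 ^ n *
        (H * (G n * (P n / stepRatio n / P n) ^ profileOrder n)) +
      B n / L ^ N * (H * (G n * (stepRatio n * s / P n) ^ profileOrder n)) ^ 2 ≤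
      H * (G (n + 1) * (s / P (n + 1)) ^ profileOrder (n + 1)) := by
  have hL := h.L_pos
  have hA := h.const_pos n
  have h₀ := h.P_pos n
  have h₁ := h.P_pos (n + 1)
  have hρ := stepRatio_pos n
  have hG := h.G_pos n
  have hG1 := h.G_le n
  have hG' := h.G_pos (n + 1)
  have hs0 : 0 < s := hL.trans_le hs
  have hle : stepRatio n * s / P n ≤ 1 := by
    rw [div_le_one h₀]
    exact le_trans (by gcongr) (h.ratio_mul_lt n).le
  have hle' : s / (P n / stepRatio n) = stepRatio n * s / P n := by field_simp
  have hP1 : P n / stepRatio n / P n ≤ 1 := by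
    rw [div_div, div_le_one (by positivity)]
    nlinarith [one_lt_stepRatio n]
  have hP2 : (P n / stepRatio n / P n) ^ profileOrder n ≤ 1 := pow_le_one₀ (by positivity) hP1
  rw [hle']
  set A := B n / L ^ N
  set x := stepRatio n * s / P n with hx
  have hx0 : 0 < x := by positivity
  rcases lt_or_ge n n₀ with hn | hn
  · have ha := h.amplify n hn
    have h₂ : x ^ profileOrder n ≤ 1 := pow_le_one₀ hx0.le hle
    have h₂' : x ^ 2 ^ n ≤ 1 := pow_le_one₀ hx0.le hle
    have h₃ := h.L_pow_le hs (n := n + 1) (profileOrder_succ n).le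
    have h₄ : (2 : ℝ) ≤ 2 ^ (n + 2) := by
      calc (2 : ℝ) = 2 ^ 1 := by norm_num
        _ ≤ _ := pow_le_pow_right₀ one_le_two (by omega)
    calc _ ≤ A * 1 * (H * (G n * 1)) + A * (H * (G n * 1)) ^ 2 := by gcongr
      _ = H * (A * (1 + H * G n) * G n) := by ring
      _ ≤ H * (A * (1 + 1 * 1) * G n) := by gcongr
      _ ≤ H * (A * 2 ^ (n + 2) * G n) := by
        gcongr
        linarith
      _ ≤ H * (G (n + 1) * L ^ 2 ^ n) := by gcongr
      _ ≤ _ := by gcongr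
  · have hc := h.contract n hn
    rw [h.G_eq n hn, h.G_eq (n + 1) (by omega), one_mul, one_mul, one_mul, profileOrder_succ]
    set θ := P (n + 1) / P n with hθ
    have hθ0 : 0 < θ := by positivity
    have e₁ : x = stepRatio n * (θ * (s / P (n + 1))) := by
      rw [hθ, hx]; field_simp
    have e₂ : x ^ 2 ^ n = 2 * (θ ^ 2 ^ n * (s / P (n + 1)) ^ 2 ^ n) := by
      rw [e₁, mul_pow, mul_pow, stepRatio_pow]
    have h₄ : (4 : ℝ) ≤ (2 ^ (n + 3)) ^ 2 := by
      rw [← pow_mul]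
      calc (4 : ℝ) = 2 ^ 2 := by norm_num
        _ ≤ _ := pow_le_pow_right₀ one_le_two (by omega)
    have h₅ : A * 4 * θ ^ 2 ^ n ≤ 1 := by
      calc A * 4 * θ ^ 2 ^ n ≤ A * 4 * (1 / (A * 2 ^ (n + 3)) ^ 2) := by gcongr
        _ = A * 4 / (A ^ 2 * (2 ^ (n + 3)) ^ 2) := by ring
        _ ≤ 1 := by
          rw [div_le_one (by positivity)]
          have : A ≤ A ^ 2 := by nlinarith
          gcongr
    have e₃ : (x ^ profileOrder n) ^ 2 = x ^ 2 ^ n := by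
      rw [← pow_mul, mul_comm _ 2, two_mul_profileOrder (h.one_le_n₀.trans hn)]
    calc _ ≤ A * x ^ 2 ^ n * (H * 1) + A * (H * H * (x ^ profileOrder n) ^ 2) := by
          rw [mul_pow, sq H]; gcongr
      _ ≤ A * x ^ 2 ^ n * (H * 1) + A * (H * 1 * (x ^ profileOrder n) ^ 2) := by gcongr
      _ = H * (A * 4 * θ ^ 2 ^ n * (s / P (n + 1)) ^ 2 ^ n) := by rw [e₃, e₂]; ring
      _ ≤ H * (1 * (s / P (n + 1)) ^ 2 ^ n) := by gcongr
      _ = _ := by ring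

end IsSchedule

/-! ### Construction of a schedule. -/

theorem sum_tail_geometric_le (n₀ n : ℕ) :
    ∑ i ∈ Finset.range n, (if n₀ ≤ i then (1 : ℝ) / 2 ^ i else 0) ≤
      2 / 2 ^ n₀ - 2 / 2 ^ (max n n₀) := by
  induction n with
  | zero => simp
  | succ n ih =>
    rw [Finset.sum_range_succ]
    split_ifs with hn
    · rw [max_eq_left hn] at ih
      rw [max_eq_left (by omega)]
      have : (2 : ℝ) / 2 ^ (n + 1) = 1 / 2 ^ n := by rw [pow_succ]; field_simp
      have : (2 : ℝ) / 2 ^ n = 1 / 2 ^ n + 1 / 2 ^ n := by ring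
      linarith
    · rw [max_eq_right (by omega)] at ih ⊢
      linarith

/-- The radii must absorb powers of `1/L`, while `L` must stay below them. Because the `n`-th loss
enters the logarithm of the radius divided by `2^n`, starting at `n₀` with `8 * N ≤ 2^n₀` bounds the
total loss by one factor `σ`, and `L = σ²` is consistent. -/
theorem exists_isSchedule {N n₀ : ℕ} (hn₀ : 1 ≤ n₀) (hN : 8 * N ≤ 2 ^ n₀) {B : ℕ → ℝ}
    (hB : ∀ n, 1 ≤ B n) (hBs : Summable fun n => Real.log (B n) / 2 ^ n) :
    ∃ ε : ℝ, 0 < ε ∧ ∀ τ : ℝ, 0 < τ → τ ≤ 1 → ∃ (L : ℝ) (P G : ℕ → ℝ),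
      IsSchedule N n₀ B L P G ∧ P 0 = τ ∧ G 0 = ε * τ ^ (2 * (N + 2 ^ n₀) * n₀) := by
  -- Chosen so that `exp (-(2^n * c n))` is exactly the contraction required when the factor `L ^
  -- (-N)` is ignored.
  let c : ℕ → ℝ := fun n => 2 / 2 ^ n * Real.log (B n * 2 ^ (n + 3))
  have hB0 : ∀ n, 0 < B n := fun n => one_pos.trans_le (hB n)
  have hc0 : ∀ n, 0 ≤ c n := fun n => by
    refine mul_nonneg (by positivity) (Real.log_nonneg ?_)
    exact one_le_mul_of_one_le_of_one_le (hB n) (one_le_pow₀ one_le_two)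
  have hcs : Summable c := by
    have h₁ : Summable fun n : ℕ => ((n : ℝ) ^ 1 * (1 / 2 : ℝ) ^ n) :=
      summable_pow_mul_geometric_of_norm_lt_one 1 (by norm_num)
    have h₂ : Summable fun n : ℕ => (1 / 2 : ℝ) ^ n :=
      summable_geometric_of_lt_one (by norm_num) (by norm_num)
    refine (((hBs.mul_left 2).add (h₁.mul_left (2 * Real.log 2))).add
      (h₂.mul_left (6 * Real.log 2))).congr fun n => ?_
    simp only [c]
    rw [Real.log_mul (hB0 n).ne' (by positivity), Real.log_pow, one_div_pow]
    push_cast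
    field_simp
    ring
  set Γ := ∑' n, c n with hΓ
  set Bs := ∏ i ∈ Finset.range n₀, B i with hBs'
  have hBs1 : 1 ≤ Bs := Finset.one_le_prod fun i _ => hB i
  set m₁ := N + 2 ^ n₀ with hm₁
  refine ⟨((Real.exp (-Γ) / 2) ^ (2 * m₁) / (Bs * 2 ^ (n₀ + 2))) ^ n₀, by positivity,
    fun τ hτ hτ1 => ?_⟩
  have hΓ0 : 0 ≤ Γ := tsum_nonneg hc0
  -- The choice making `τ * e^(-Γ) * σ = 2 * σ²`: the left side bounds all radii from below, and the
  -- right side is `2 * L`.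
  set σ := τ * (Real.exp (-Γ) / 2) with hσ
  have hσ0 : 0 < σ := by positivity
  have hσ1 : σ ≤ 1 := by
    have : Real.exp (-Γ) ≤ 1 := Real.exp_le_one_iff.2 (by linarith)
    nlinarith [Real.exp_pos (-Γ)]
  have hlog : 0 ≤ -Real.log σ := by linarith [Real.log_nonpos hσ0.le hσ1]
  -- The extra term contributes `σ^(4N) = L^(2N)` to the contraction, the square of the missing
  -- factor `L^N`.
  let C : ℕ → ℝ := fun n => c n + if n₀ ≤ n then 1 / 2 ^ n * (4 * N * -Real.log σ) else 0
  have hcC : ∀ n, c n ≤ C n := fun n => by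
    simp only [C]
    split_ifs
    · have : 0 ≤ 1 / 2 ^ n * (4 * N * -Real.log σ) := by positivity
      linarith
    · linarith
  have hCsum : ∀ n, ∑ i ∈ Finset.range n, C i ≤ Γ - Real.log σ := fun n => by
    have h₁ : ∑ i ∈ Finset.range n, c i ≤ Γ := hcs.sum_le_tsum _ fun i _ => hc0 i
    have h₂ := sum_tail_geometric_le n₀ n
    have h₃ : ∑ i ∈ Finset.range n, (if n₀ ≤ i then 1 / 2 ^ i * (4 * N * -Real.log σ) else 0) =
        (∑ i ∈ Finset.range n, (if n₀ ≤ i then (1 : ℝ) / 2 ^ i else 0)) *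
          (4 * N * -Real.log σ) := by
      rw [Finset.sum_mul]
      refine Finset.sum_congr rfl fun i _ => ?_
      split_ifs <;> simp
    have h₄ : (∑ i ∈ Finset.range n, (if n₀ ≤ i then (1 : ℝ) / 2 ^ i else 0)) *
          (4 * N * -Real.log σ) ≤ 2 / 2 ^ n₀ * (4 * N * -Real.log σ) := by
      gcongr
      have : (0 : ℝ) ≤ 2 / 2 ^ (max n n₀) := by positivity
      linarith
    have h₅ : 2 / 2 ^ n₀ * (4 * N * -Real.log σ) ≤ -Real.log σ := by
      have h₆ : (8 * N : ℝ) ≤ 2 ^ n₀ := by exact_mod_cast hN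
      have h₇ : 8 * (N : ℝ) / 2 ^ n₀ ≤ 1 := by rw [div_le_one (by positivity)]; exact h₆
      calc 2 / 2 ^ n₀ * (4 * N * -Real.log σ) = 8 * N / 2 ^ n₀ * -Real.log σ := by ring
        _ ≤ 1 * -Real.log σ := by gcongr
        _ = _ := one_mul _
    simp only [C, Finset.sum_add_distrib]
    linarith
  let P : ℕ → ℝ := fun n => τ * Real.exp (-∑ i ∈ Finset.range n, C i)
  let L := σ ^ 2
  have hL0 : 0 < L := by positivity
  have hL1 : L ≤ 1 := pow_le_one₀ hσ0.le hσ1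
  have hratio : ∀ n, (P (n + 1) / P n) ^ 2 ^ n = Real.exp (-(2 ^ n * C n)) := fun n => by
    have : P (n + 1) / P n = Real.exp (-C n) := by
      simp only [P]
      rw [Finset.sum_range_succ, neg_add, Real.exp_add]
      field_simp
    rw [this, ← Real.exp_nat_mul]
    push_cast
    ring_nf
  have hexpc : ∀ n, Real.exp (-(2 ^ n * c n)) = 1 / (B n * 2 ^ (n + 3)) ^ 2 := fun n => by
    have hpos : 0 < B n * 2 ^ (n + 3) := mul_pos (hB0 n) (by positivity)
    have : 2 ^ n * c n = ((2 : ℕ) : ℝ) * Real.log (B n * 2 ^ (n + 3)) := by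
      simp only [c]; push_cast; field_simp
    rw [this, Real.exp_neg, Real.exp_nat_mul, Real.exp_log hpos, one_div]
  -- One factor `g` outweighs the constant of any of the first `n₀` steps together with the profile
  -- minimum `L^(2^n)`.
  set g := L ^ m₁ / (Bs * 2 ^ (n₀ + 2)) with hg
  have hg0 : 0 < g := by positivity
  have hg1 : g ≤ 1 := by
    rw [hg, div_le_one (by positivity)]
    calc L ^ m₁ ≤ 1 := pow_le_one₀ hL0.le hL1
      _ ≤ _ := one_le_mul_of_one_le_of_one_le hBs1 (one_le_pow₀ one_le_two)
  -- Truncated subtraction makes the amplitude equal to `1` from `n₀` on.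
  refine ⟨L, P, fun n => g ^ (n₀ - n), ⟨hn₀, hB, hL0, ?_, ?_, ?_, fun n => by positivity,
    fun n => pow_le_one₀ hg0.le hg1, ?_, ?_, ?_⟩, ?_, ?_⟩
  · intro n
    have : Real.exp (-Γ) * σ ≤ Real.exp (-∑ i ∈ Finset.range n, C i) := by
      calc Real.exp (-Γ) * σ = Real.exp (-Γ + Real.log σ) := by
            rw [Real.exp_add, Real.exp_log hσ0]
        _ ≤ _ := Real.exp_le_exp.2 (by linarith [hCsum n])
    calc 2 * L = τ * (Real.exp (-Γ) * σ) := by simp only [L, hσ]; ring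
      _ ≤ _ := by simp only [P]; gcongr
  · intro n
    have : Real.exp (-∑ i ∈ Finset.range n, C i) ≤ 1 := by
      refine Real.exp_le_one_iff.2 (neg_nonpos.2 (Finset.sum_nonneg fun i _ => ?_))
      exact (hc0 i).trans (hcC i)
    simp only [P]
    nlinarith [Real.exp_pos (-∑ i ∈ Finset.range n, C i)]
  · intro n
    rw [hratio]
    calc Real.exp (-(2 ^ n * C n)) ≤ Real.exp (-(2 ^ n * c n)) := by
          gcongr
          exact hcC n
      _ = 1 / (B n * 2 ^ (n + 3)) ^ 2 := hexpc n
      _ ≤ 1 / 4 := by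
        have h₁ : (2 : ℝ) ≤ 2 ^ (n + 3) := by
          calc (2 : ℝ) = 2 ^ 1 := by norm_num
            _ ≤ _ := pow_le_pow_right₀ one_le_two (by omega)
        have h₂ : 2 ≤ B n * 2 ^ (n + 3) := by nlinarith [hB n]
        gcongr
        nlinarith
  · intro n hn
    have e : n₀ - n = (n₀ - (n + 1)) + 1 := by omega
    change B n / L ^ N * 2 ^ (n + 2) * g ^ (n₀ - n) ≤ g ^ (n₀ - (n + 1)) * L ^ 2 ^ n
    rw [e, pow_succ]
    have hBn : B n ≤ Bs := by
      rw [hBs', ← Finset.mul_prod_erase _ _ (Finset.mem_range.2 hn)]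
      exact le_mul_of_one_le_right (hB0 n).le (Finset.one_le_prod fun i _ => hB i)
    have h₂ : (2 : ℝ) ^ (n + 2) ≤ 2 ^ (n₀ + 2) := pow_le_pow_right₀ one_le_two (by omega)
    have h₃ : L ^ 2 ^ n₀ ≤ L ^ 2 ^ n :=
      pow_le_pow_of_le_one hL0.le hL1 (Nat.pow_le_pow_right two_pos hn.le)
    have h₁ : B n / L ^ N * 2 ^ (n + 2) * g ≤ L ^ 2 ^ n := by
      calc B n / L ^ N * 2 ^ (n + 2) * g ≤ Bs / L ^ N * 2 ^ (n₀ + 2) * g := by gcongr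
        _ = L ^ 2 ^ n₀ := by rw [hg, hm₁, pow_add]; field_simp; rw [pow_add]
        _ ≤ _ := h₃
    calc _ = g ^ (n₀ - (n + 1)) * (B n / L ^ N * 2 ^ (n + 2) * g) := by ring
      _ ≤ _ := by gcongr
  · intro n hn
    simp [Nat.sub_eq_zero_of_le hn]
  · intro n hn
    rw [hratio]
    have e : 2 ^ n * C n = 2 ^ n * c n + (4 * N : ℕ) * -Real.log σ := by
      simp only [C, if_pos hn]; push_cast; field_simp
    rw [e, neg_add, Real.exp_add, hexpc, mul_neg, neg_neg, Real.exp_nat_mul, Real.exp_log hσ0]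
    apply le_of_eq
    have := hB0 n
    simp only [L]
    rw [← pow_mul, show 4 * N = (2 * N) * 2 by ring, pow_mul]
    field_simp
  · simp [P]
  · change g ^ (n₀ - 0) = _
    rw [Nat.sub_zero, pow_mul τ, ← mul_pow, hg]
    congr 1
    simp only [L, hσ]
    rw [← pow_mul, mul_pow]
    ring

/-! ### The induction step for profiles. -/

namespace LocalInverse

variable {k : ℝ} {A : ArnoldAction k} {Tr : Transversal A} {J : LocalInverse Tr}

/-- The bounds on the state `(d, r)` over `(n, u)` that are preserved by the Lie iteration. -/
def InProfile (L : ℝ) (P G : ℕ → ℝ) (H : ℝ) (n : ℕ) {u : Pos} (d : Tr.T.car n u)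
    (r : A.M.car n u) : Prop :=
  ‖d‖ ≤ 1 - (1 / 2) ^ n ∧ ∀ (s : Pos) (hs : s ≤ u), L ≤ s → (s : ℝ) ≤ P n →
    ‖A.M.res le_rfl hs r‖ ≤ H * (G n * ((s : ℝ) / P n) ^ profileOrder n)

theorem InProfile.norm_le_one {L : ℝ} {P G : ℕ → ℝ} {H : ℝ} {n : ℕ} {u : Pos} {d : Tr.T.car n u}
    {r : A.M.car n u} (h : InProfile L P G H n d r) : ‖d‖ ≤ 1 :=
  h.1.trans (sub_le_self _ (by positivity))

variable {α β γ ν ξ : ℝ × ℝ} {K n N n₀ : ℕ} {a F L H : ℝ} {B P G : ℕ → ℝ}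

theorem InProfile.const_mul_norm_le (hS : IsSchedule N n₀ B L P G) (hH : 0 ≤ H)
    {u : Pos} {d : Tr.T.car n u} {r : A.M.car n u} (hin : InProfile L P G H n d r) {s p : Pos}
    (hs : L ≤ s) (hsP : (s : ℝ) ≤ P (n + 1)) (hp : (p : ℝ) = stepRatio n * s) (hpu : p ≤ u) :
    B n / L ^ N * ‖A.M.res le_rfl hpu r‖ ≤
      H * (1 / 2) ^ (n + 2) * ((s : ℝ) / P (n + 1)) ^ profileOrder n := by
  have h₁ := hS.const_pos n
  have h₂ := one_lt_stepRatio n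
  have h₃ := s.2
  have hLp : L ≤ p := by rw [hp]; nlinarith
  have hpP : (p : ℝ) ≤ P n := by
    rw [hp]
    exact le_trans (mul_le_mul_of_nonneg_left hsP (stepRatio_pos n).le) (hS.ratio_mul_lt n).le
  have h₄ := hin.2 p hpu hLp hpP
  rw [hp] at h₄
  exact (mul_le_mul_of_nonneg_left h₄ (by linarith)).trans (hS.linear_estimate hH n hs hsP)

theorem half_bound (hS : IsSchedule N n₀ B L P G) (hH1 : H ≤ 1) (n : ℕ) {s : ℝ}
    (hs0 : 0 < s) (hsP : s ≤ P (n + 1)) :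
    H * (1 / 2) ^ (n + 2) * (s / P (n + 1)) ^ profileOrder n ≤ (1 / 2) ^ (n + 2) := by
  have h₁ := hS.P_pos (n + 1)
  have h₂ : (s / P (n + 1)) ^ profileOrder n ≤ 1 :=
    pow_le_one₀ (by positivity) ((div_le_one h₁).2 hsP)
  calc _ ≤ 1 * (1 / 2 : ℝ) ^ (n + 2) * 1 := by gcongr
    _ = _ := by ring

theorem half_pow_le_half (n : ℕ) : (1 / 2 : ℝ) ^ (n + 2) ≤ 1 / 2 := by
  calc (1 / 2 : ℝ) ^ (n + 2) ≤ (1 / 2) ^ 1 :=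
        pow_le_pow_of_le_one (by norm_num) (by norm_num) (by omega)
    _ = _ := pow_one _

/-- The new remainder splits as Taylor error plus defect. For each `s` the Taylor error is estimated
from the radius `stepRatio n * s`, and the defect from one fixed radius `P n / stepRatio n`, so that
the cutoff factor is a power of `s`; `quadratic_estimate` adds them up. -/
theorem StepData.exists_step (hk : 0 < k) (h : J.StepData α β γ ν ξ K n a F)
    (hS : IsSchedule N n₀ B L P G) (hA : stepConst K a F (stepGap L n) = B n / L ^ N)
    (hH : 0 ≤ H) (hH1 : H ≤ 1) {u v : Pos} (hvu : v < u) (hPu : P n ≤ u) (hv : (v : ℝ) = P (n + 1))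
    (d : Tr.T.car n u) (r : A.M.car n u) (hin : InProfile L P G H n d r) :
    ∃ (d' : Tr.T.car (n + 1 : ℕ) v) (r' : A.M.car (n + 1 : ℕ) v),
      InProfile L P G H (n + 1) d' r' ∧ J.IsLieStep n hvu d hin.norm_le_one r d' r' ∧
      Summable (OpenOpFamily.expTerm (-(J.gen n le_rfl d r)) hvu
        (A.f.val n u + (d : A.E.fib n u) + (r : A.E.fib n u))) ∧
      ∀ (s : Pos) (hs : s ≤ v), L ≤ s →
        ‖Tr.T.res le_rfl hs (d' - Tr.T.res (coe_le_coe_succ n) hvu.le d)‖ ≤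
          H * (1 / 2) ^ (n + 2) * ((s : ℝ) / P (n + 1)) ^ profileOrder n := by
  have hL := hS.L_pos
  have hℓ := stepGap_pos hL n
  have hρ := stepRatio_pos n
  have hd := hin.norm_le_one
  have hApos := hS.const_pos n
  have hLv : L ≤ v := by rw [hv]; linarith [hS.two_L_le (n + 1)]
  -- the larger radius used for the estimates over `s`
  let up : Pos → Pos := fun s => ⟨stepRatio n * s, mul_pos hρ s.2⟩
  have hupP : ∀ s ≤ v, (up s : ℝ) ≤ P n := fun s hs => by
    refine le_trans ?_ (hS.ratio_mul_lt n).le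
    rw [← hv]
    exact mul_le_mul_of_nonneg_left hs hρ.le
  have hupu : ∀ s ≤ v, up s ≤ u := fun s hs => (hupP s hs).trans hPu
  have hup1 : ∀ s ≤ v, (up s : ℝ) ≤ 1 := fun s hs => (hupP s hs).trans (hS.P_le n)
  have hsP : ∀ s ≤ v, (s : ℝ) ≤ P (n + 1) := fun s hs => le_trans hs hv.le
  have hgap : ∀ s : Pos, L ≤ s → (s : ℝ) + 4 * stepGap L n ≤ up s := fun s hs =>
    add_stepGap_le hL hs n
  have hAX : ∀ (s : Pos) (hs : s ≤ v), L ≤ s →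
      B n / L ^ N * ‖A.M.res le_rfl (hupu s hs) r‖ ≤
      H * (1 / 2) ^ (n + 2) * ((s : ℝ) / P (n + 1)) ^ profileOrder n := fun s hs hLs =>
    hin.const_mul_norm_le hS hH hLs (hsP s hs) rfl (hupu s hs)
  have hhalf : ∀ (s : Pos) (hs : s ≤ v), L ≤ s →
      stepConst K a F (stepGap L n) * ‖A.M.res le_rfl (hupu s hs) r‖ ≤ 1 / 2 :=
    fun s hs hLs => by
      rw [hA]
      exact (hAX s hs hLs).trans ((half_bound hS hH1 n s.2 (hsP s hs)).trans
        (half_pow_le_half n))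
  have hexp : ∀ (s : Pos) (hs : s ≤ v) (hLs : L ≤ s), _ := fun s hs hLs =>
    h.exp_estimate hk hℓ d hd r ((stepGap_le hL n).trans hLs) (hgap s hLs) (hup1 s hs) (hupu s hs)
      (hs.trans_lt hvu) (hhalf s hs hLs)
  have hsum := (hexp v le_rfl hLv).1
  have hmem : OpenOpFamily.exp (-(J.gen n le_rfl d r)) hvu
      (A.f.val n u + (d : A.E.fib n u) + (r : A.E.fib n u)) - A.f.val n v ∈ A.M.car n v := by
    rw [add_assoc] at hsum ⊢
    exact J.exp_neg_gen_sub_mem n d hd le_rfl r hvu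
      (Submodule.add_mem _ (Tr.T_le_M _ _ d.2) r.2) hsum
  let inc : Tr.T.car n v := ⟨J.incr n le_rfl d hd r hvu, Tr.proj_mem _ _ _⟩
  -- The new remainder, still over index `n`; passing to index `n + 1` is a restriction and does not
  -- increase norms.
  let R : A.M.car n v := ⟨_, hmem⟩ - A.M.res le_rfl hvu.le ⟨d, Tr.T_le_M _ _ d.2⟩ -
    J.incr n le_rfl d hd r hvu
  have hR : (R : A.E.fib n v) = OpenOpFamily.exp (-(J.gen n le_rfl d r)) hvu
      (A.f.val n u + (d : A.E.fib n u) + (r : A.E.fib n u)) - A.f.val n v -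
      A.E.res le_rfl hvu.le (d : A.E.fib n u) - (J.incr n le_rfl d hd r hvu : A.E.fib n v) := rfl
  have hinc : ∀ (s : Pos) (hs : s ≤ v), L ≤ s →
      ‖Tr.T.res le_rfl hs (Tr.T.res (coe_le_coe_succ n) le_rfl inc)‖ ≤
        H * (1 / 2) ^ (n + 2) * ((s : ℝ) / P (n + 1)) ^ profileOrder n := fun s hs hLs => by
    rw [Tr.T.res_res, ← Tr.T.res_res le_rfl (coe_le_coe_succ n) hs le_rfl]
    refine (Tr.T.norm_res_le _ _ _).trans ?_
    have h₁ : ‖Tr.T.res le_rfl hs inc‖ = ‖J.incr n le_rfl d hd r (hs.trans_lt hvu)‖ := by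
      rw [← J.res_incr n d hd le_rfl r hs hvu]; rfl
    rw [h₁]
    refine le_trans ?_ (hAX s hs hLs)
    rw [← hA]
    exact h.norm_incr_le hℓ d hd r ((stepGap_le hL n).trans hLs) (hgap s hLs) (hup1 s hs)
      (hupu s hs) _
  refine ⟨Tr.T.res (coe_le_coe_succ n) hvu.le d + Tr.T.res (coe_le_coe_succ n) le_rfl inc,
    A.M.res (coe_le_coe_succ n) le_rfl R, ⟨?_, ?_⟩, ⟨rfl, ?_⟩, hsum, ?_⟩
  · have h₁ := hinc v le_rfl hLv
    rw [Tr.T.res_self] at h₁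
    have h₂ := h₁.trans (half_bound hS hH1 n v.2 (hsP v le_rfl))
    have h₃ := (Tr.T.norm_res_le (coe_le_coe_succ n) hvu.le d).trans hin.1
    refine (norm_add_le _ _).trans ?_
    have h₄ : (1 / 2 : ℝ) ^ (n + 2) ≤ (1 / 2) ^ n - (1 / 2) ^ (n + 1) := by
      rw [pow_succ, pow_succ]
      have : (0 : ℝ) < (1 / 2) ^ n := by positivity
      linarith
    linarith
  · intro s hs hLs hsP'
    rw [A.M.res_res, ← A.M.res_res le_rfl (coe_le_coe_succ n) hs le_rfl]
    refine (A.M.norm_res_le _ _ _).trans ?_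
    have hsu := hs.trans_lt hvu
    have hU := (J.gen_isHorizontal n d hd le_rfl r).neg
    -- Adding and subtracting `r - u(f + d)` separates the second order part from the defect.
    have e : (A.M.res le_rfl hs R : A.E.fib n s) =
        (OpenOpFamily.exp (-(J.gen n le_rfl d r)) hsu
          (A.f.val n u + (d : A.E.fib n u) + (r : A.E.fib n u)) -
          A.E.res le_rfl hsu.le (A.f.val n u + (d : A.E.fib n u)) -
          (J.remainder n le_rfl d hd r hsu : A.E.fib n s)) +
        (J.defect n le_rfl d hd r hsu : A.E.fib n s) := by
      rw [A1Subspace.coe_res, hR, map_sub, map_sub, map_sub, hU.res_exp hs hvu _ hsum,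
        A.f.horizontal, A.E.res_res, map_add, A.f.horizontal, defect, Submodule.coe_sub,
        ← J.res_incr n d hd le_rfl r hs hvu, A1Subspace.coe_res]
      abel
    change ‖(A.M.res le_rfl hs R : A.E.fib n s)‖ ≤ _
    rw [e]
    -- Staying strictly below `P n` leaves the gap that the dependence of `κ` on `d` requires.
    let t : Pos := ⟨P n / stepRatio n, div_pos (hS.P_pos n) hρ⟩
    let p : Pos := ⟨P n, hS.P_pos n⟩
    have htp : (p : ℝ) = stepRatio n * t := by
      change P n = stepRatio n * (P n / stepRatio n)
      field_simp
    have hρt : stepRatio n * s ≤ t := by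
      change stepRatio n * s ≤ P n / stepRatio n
      rw [le_div_iff₀ hρ]
      refine le_trans (le_of_eq (by ring))
        ((mul_le_mul_of_nonneg_left hsP' (sq_nonneg (stepRatio n))).trans (hS.ratio_sq_mul_le n))
    have hLt : L ≤ t := by
      refine hLs.trans (le_trans ?_ hρt)
      nlinarith [one_lt_stepRatio n, s.2]
    have h4t := add_stepGap_le hL hLt n
    rw [← htp] at h4t
    have hpu : p ≤ u := hPu
    have htp' : t < p := by change (t : ℝ) < p; linarith
    have htu : t ≤ u := htp'.le.trans hpu
    have h₁ := (hexp s hs hLs).2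
    have hgap' : (s : ℝ) + 4 * stepGap L n ≤ stepRatio n * s := hgap s hLs
    have h₂ := h.norm_defect_le hℓ d hd r ((stepGap_le hL n).trans hLs) (t := t) (p := p)
      (by linarith) (by linarith) (hS.P_le n) hpu htu hsu
    rw [hA] at h₁ h₂
    have hq := hin.2 (up s) (hupu s hs) (hLs.trans (by linarith [hgap s hLs])) (hupP s hs)
    have hl := hin.2 t htu hLt (le_of_lt htp')
    have hst0 : 0 ≤ (s : ℝ) / t := div_nonneg s.2.le t.2.le
    refine (norm_add_le _ _).trans ?_
    rw [add_comm]
    refine le_trans (add_le_add (h₂.trans ?_) (h₁.trans ?_))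
      (hS.quadratic_estimate hH hH1 n hLs hsP')
    · exact mul_le_mul_of_nonneg_left hl (by positivity)
    · refine mul_le_mul_of_nonneg_left (pow_le_pow_left₀ (norm_nonneg _) hq 2) (by linarith)
  · rw [A1Subspace.coe_res, hR, map_sub, map_sub, map_sub, A.f.horizontal, A.E.res_res]
    change A.f.val (n + 1 : ℕ) v + (A.E.res (coe_le_coe_succ n) hvu.le (d : A.E.fib n u) +
      A.E.res (coe_le_coe_succ n) le_rfl (J.incr n le_rfl d hd r hvu : A.E.fib n v)) + _ = _
    abel
  · intro s hs hLs
    rw [add_sub_cancel_left]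
    exact hinc s hs hLs

end LocalInverse

/-! ### Convergence from geometric bounds on the increments. -/

theorem exists_dependent_seq {X : ℕ → Type*} (x₀ : X 0) {R : ∀ n, X n → X (n + 1) → Prop}
    (h : ∀ n x, ∃ y, R n x y) : ∃ x : ∀ n, X n, x 0 = x₀ ∧ ∀ n, R n (x n) (x (n + 1)) := by
  choose next hnext using h
  exact ⟨fun n => Nat.rec x₀ (fun n x => next n x) n, rfl, fun n => hnext n _⟩

namespace LieIteration

variable {k : ℝ} {A : ArnoldAction k} {Tr : Transversal A} {J : LocalInverse Tr} {s : FallingSeq}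

theorem norm_res_d_sub_le (L : LieIteration J s) (h : ∀ n, ‖L.inc n‖ ≤ (1 / 2) ^ (n + 1)) {n m : ℕ}
    (hnm : n ≤ m) :
    ‖Tr.T.res (Nat.cast_le.2 hnm) (s.anti.antitone hnm) (L.d n) - L.d m‖ ≤
      (1 / 2) ^ n - (1 / 2) ^ m := by
  induction m, hnm using Nat.le_induction with
  | base => rw [A1Subspace.res_self]; simp
  | succ m hnm ih =>
    have e : Tr.T.res (Nat.cast_le.2 (hnm.trans m.le_succ)) (s.anti.antitone (hnm.trans m.le_succ))
        (L.d n) - L.d (m + 1) = Tr.T.res (coe_le_coe_succ m) (s.succ_lt m).le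
          (Tr.T.res (Nat.cast_le.2 hnm) (s.anti.antitone hnm) (L.d n) - L.d m) - L.inc m := by
      rw [L.d_succ m]
      apply Subtype.ext
      simp only [Submodule.coe_sub, Submodule.coe_add, A1Subspace.coe_res, map_sub, A.E.res_res]
      abel
    rw [e]
    refine (norm_sub_le _ _).trans ((add_le_add ((Tr.T.norm_res_le _ _ _).trans ih) (h m)).trans ?_)
    have h₁ : (1 / 2 : ℝ) ^ (m + 1) = (1 / 2) ^ m / 2 := by rw [pow_succ]; ring
    linarith

theorem tau_isCauchy (L : LieIteration J s) (h : ∀ n, ‖L.inc n‖ ≤ (1 / 2) ^ (n + 1)) :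
    L.tau.IsCauchy := by
  intro η hη
  obtain ⟨N, hN⟩ := exists_pow_lt_of_lt_one hη (show (1 / 2 : ℝ) < 1 by norm_num)
  refine ⟨N, fun n m hn hnm => ?_⟩
  have e : A.E.res (Nat.cast_le.2 hnm) (s.anti.antitone hnm) (L.tau n) - L.tau m =
      ((Tr.T.res (Nat.cast_le.2 hnm) (s.anti.antitone hnm) (L.d n) - L.d m : Tr.T.car m (s.val m)) :
        A.E.fib m (s.val m)) := by
    simp only [tau, map_add, A.f.horizontal, Submodule.coe_sub, A1Subspace.coe_res]
    abel
  rw [e]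
  refine lt_of_le_of_lt (L.norm_res_d_sub_le h hnm) ?_
  have h₁ : (1 / 2 : ℝ) ^ n ≤ (1 / 2) ^ N := pow_le_pow_of_le_one (by norm_num) (by norm_num) hn
  have h₂ : (0 : ℝ) < (1 / 2) ^ m := by positivity
  linarith

theorem converges_of_norm_inc_le (L : LieIteration J s) (h : ∀ n, ‖L.inc n‖ ≤ (1 / 2) ^ (n + 1))
    (hr : Tendsto (fun n => ‖L.r n‖) atTop (𝓝 0)) : L.Converges := by
  have hτ := L.tau_isCauchy h
  have hlim : ∃ y ∈ Tr.T.car ⊤ s.lim,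
      Tendsto (fun n => A.E.res le_top (s.lim_le n) (L.d n : A.E.fib n (s.val n))) atTop (𝓝 y) := by
    have hc : CauchySeq fun n => A.E.res le_top (s.lim_le n) (L.d n : A.E.fib n (s.val n)) := by
      refine cauchySeq_of_le_geometric (1 / 2) (1 / 2) (by norm_num) fun n => ?_
      have e : A.E.res le_top (s.lim_le n) (L.d n : A.E.fib n (s.val n)) -
          A.E.res le_top (s.lim_le (n + 1)) (L.d (n + 1) : A.E.fib (n + 1 : ℕ) (s.val (n + 1))) =
          -A.E.res le_top (s.lim_le (n + 1)) (L.inc n : A.E.fib (n + 1 : ℕ) (s.val (n + 1))) := by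
        rw [L.d_succ n, Submodule.coe_add, map_add, A1Subspace.coe_res, A.E.res_res]
        abel
      rw [dist_eq_norm, e, norm_neg]
      refine (A.E.norm_res_le _ _ _).trans ((h n).trans (le_of_eq ?_))
      rw [pow_succ]; ring
    obtain ⟨y, hy⟩ := cauchySeq_tendsto_of_complete hc
    exact ⟨y, (Tr.T.isClosed _ _).mem_of_tendsto hy
      (Eventually.of_forall fun n => Tr.T.res_mem _ _ _ (L.d n).2), hy⟩
  obtain ⟨y, hyT, hy⟩ := hlim
  have hτlim : L.tau.ConvergesTo (A.f.val ⊤ s.lim + y) := by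
    refine (hy.const_add (A.f.val ⊤ s.lim)).congr fun n => ?_
    rw [tau, map_add, A.f.horizontal]
  have hrlim : Tendsto (fun n => A.E.res le_top (s.lim_le n) (L.r n : A.E.fib n (s.val n))) atTop
      (𝓝 0) :=
    squeeze_zero_norm (fun n => A.E.norm_res_le _ _ _) hr
  refine ⟨fun η hη => ?_, hτ, ⟨y, hyT, ?_, hτlim⟩, hr, ?_⟩
  · obtain ⟨N₁, hN₁⟩ := hτ (η / 3) (by positivity)
    obtain ⟨N₂, hN₂⟩ := eventually_atTop.1
      (hr.eventually (gt_mem_nhds (show (0 : ℝ) < η / 3 by positivity)))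
    refine ⟨max N₁ N₂, fun n m hn hnm => ?_⟩
    have h₁ := hN₁ n m ((le_max_left _ _).trans hn) hnm
    have h₂ := hN₂ n ((le_max_right _ _).trans hn)
    have h₃ := hN₂ m (((le_max_right _ _).trans hn).trans hnm)
    have h₄ : ‖A.E.res (Nat.cast_le.2 hnm) (s.anti.antitone hnm) (L.r n : A.E.fib n (s.val n))‖ ≤
        ‖L.r n‖ := A.E.norm_res_le _ _ _
    have h₅ : ‖(L.r m : A.E.fib m (s.val m))‖ = ‖L.r m‖ := rfl
    have e : A.E.res (Nat.cast_le.2 hnm) (s.anti.antitone hnm) (L.x n) - L.x m =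
        (A.E.res (Nat.cast_le.2 hnm) (s.anti.antitone hnm) (L.tau n) - L.tau m) +
          A.E.res (Nat.cast_le.2 hnm) (s.anti.antitone hnm) (L.r n : A.E.fib n (s.val n)) -
          (L.r m : A.E.fib m (s.val m)) := by
      simp only [x, map_add]
      abel
    rw [e]
    refine (norm_sub_le _ _).trans_lt ?_
    have := norm_add_le (A.E.res (Nat.cast_le.2 hnm) (s.anti.antitone hnm) (L.tau n) - L.tau m)
      (A.E.res (Nat.cast_le.2 hnm) (s.anti.antitone hnm) (L.r n : A.E.fib n (s.val n)))
    linarith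
  · have := Tendsto.add hτlim hrlim
    rw [add_zero] at this
    refine this.congr fun n => ?_
    rw [x, map_add]
  · refine squeeze_zero (fun n => norm_nonneg _) h ?_
    exact (tendsto_pow_atTop_nhds_zero_of_lt_one (by norm_num) (by norm_num)).comp
      (tendsto_add_atTop_nat 1)

end LieIteration

/-! ### The falling sequence attached to a schedule. -/

namespace IsSchedule

variable {N n₀ : ℕ} {B : ℕ → ℝ} {L : ℝ} {P G : ℕ → ℝ}

/-- The points `t, P 1, P 2, …`. -/
def points (h : IsSchedule N n₀ B L P G) (t : Pos) : ℕ → Pos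
  | 0 => t
  | n + 1 => ⟨P (n + 1), h.P_pos (n + 1)⟩

/-- The falling sequence `t, P 1 / 2, P 2 / 2, …`. -/
def halfPoints (h : IsSchedule N n₀ B L P G) (t : Pos) : ℕ → Pos
  | 0 => t
  | n + 1 => ⟨P (n + 1) / 2, half_pos (h.P_pos (n + 1))⟩

variable (h : IsSchedule N n₀ B L P G) {t : Pos}

theorem points_succ_lt (ht : P 0 ≤ t) (n : ℕ) : h.points t (n + 1) < h.points t n := by
  have h₁ := h.P_succ_lt n
  cases n with
  | zero => exact h₁.trans_le ht
  | succ n => exact h₁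

theorem P_le_points (ht : P 0 ≤ t) (n : ℕ) : P n ≤ h.points t n := by
  cases n with
  | zero => exact ht
  | succ n => exact le_rfl

theorem halfPoints_le (n : ℕ) : h.halfPoints t n ≤ h.points t n := by
  cases n with
  | zero => exact le_rfl
  | succ n => exact half_le_self (h.P_pos (n + 1)).le

theorem half_P_le_halfPoints (ht : P 0 ≤ t) (n : ℕ) : P n / 2 ≤ h.halfPoints t n := by
  cases n with
  | zero => exact (half_le_self (h.P_pos 0).le).trans ht
  | succ n => exact le_rfl

theorem halfPoints_anti (ht : P 0 ≤ t) : StrictAnti (h.halfPoints t) := by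
  refine strictAnti_nat_of_succ_lt fun n => ?_
  have h₁ : P (n + 1) / 2 < P n / 2 := by linarith [h.P_succ_lt n]
  exact h₁.trans_le (h.half_P_le_halfPoints ht n)

theorem exists_fallingSeq (ht : P 0 ≤ t) : ∃ s : FallingSeq, s.val = h.halfPoints t := by
  have hanti : Antitone P := antitone_nat_of_succ_le fun n => (h.P_succ_lt n).le
  have hbdd : BddBelow (Set.range P) := ⟨2 * L, by rintro _ ⟨n, rfl⟩; exact h.two_L_le n⟩
  have hlim := tendsto_atTop_ciInf hanti hbdd
  have hpos : 0 < ⨅ n, P n := lt_of_lt_of_le (by linarith [h.L_pos] : 0 < 2 * L)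
    (le_ciInf h.two_L_le)
  refine ⟨⟨h.halfPoints t, h.halfPoints_anti ht, ⟨(⨅ n, P n) / 2, half_pos hpos⟩, ?_⟩, rfl⟩
  rw [tendsto_subtype_rng, ← tendsto_add_atTop_iff_nat 1]
  exact (hlim.comp (tendsto_add_atTop_nat 1)).div_const 2

end IsSchedule

/-! ### Construction of the whole iteration. -/

namespace LocalInverse

variable {k : ℝ} {A : ArnoldAction k} {Tr : Transversal A} {J : LocalInverse Tr}
  {α β γ ν ξ : ℝ × ℝ} {K N n₀ : ℕ} {a : ℕ → ℝ} {F L H : ℝ} {B P G : ℕ → ℝ}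

/-- The steps are chosen over `t, P 1, P 2, …` and restricted to `t, P 1 / 2, P 2 / 2, …`. A profile
of order `2^(n-1)` evaluated at half the radius becomes the doubly exponential factor
`(1/2)^(2^(n-1))`. -/
theorem exists_lieIteration (hk : 0 < k) (h : ∀ n, J.StepData α β γ ν ξ K n (a n) F)
    (hS : IsSchedule N n₀ B L P G) (hA : ∀ n, stepConst K (a n) F (stepGap L n) = B n / L ^ N)
    (hH : 0 ≤ H) (hH1 : H ≤ 1) {s : FallingSeq} {t : Pos} (hs : s.val = hS.halfPoints t)
    (ht : P 0 ≤ t) (r₀ : A.M.car (0 : ℕ) (s.val 0)) (hr₀ : ‖r₀‖ ≤ H * G 0) :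
    ∃ I : LieIteration J s, I.r 0 = r₀ ∧ (∀ n, ‖I.r n‖ ≤ H * (1 / 2) ^ profileOrder n) ∧
      ∀ n, ‖I.inc n‖ ≤ H * (1 / 2) ^ (n + 2) * (1 / 2) ^ profileOrder n := by
  set S := hS.points t with hSdef
  have hlt : ∀ n, S (n + 1) < S n := hS.points_succ_lt ht
  have hPS : ∀ n, P n ≤ S n := hS.P_le_points ht
  have hS1 : ∀ n, (S (n + 1) : ℝ) = P (n + 1) := fun n => rfl
  have hsS : ∀ n, s.val n ≤ S n := fun n => by rw [hs]; exact hS.halfPoints_le n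
  have hs1 : ∀ n, (s.val (n + 1) : ℝ) = P (n + 1) / 2 := fun n => by rw [hs]; rfl
  have hPs : ∀ n, P n / 2 ≤ s.val n := fun n => by rw [hs]; exact hS.half_P_le_halfPoints ht n
  have hS0 : S 0 ≤ s.val 0 := by rw [hs]; exact le_rfl
  have hLs : ∀ n, L ≤ s.val n := fun n => by linarith [hS.two_L_le n, hPs n]
  have hP := hS.P_pos
  let X : ℕ → Type _ := fun n =>
    {x : Tr.T.car n (S n) × A.M.car n (S n) // InProfile L P G H n x.1 x.2}
  have hx₀ : InProfile L P G H 0 (0 : Tr.T.car (0 : ℕ) (S 0)) (A.M.res le_rfl hS0 r₀) := by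
    refine ⟨by simp, fun s hs _ _ => ?_⟩
    rw [A.M.res_res, profileOrder_zero, pow_zero, mul_one]
    exact (A.M.norm_res_le _ _ _).trans hr₀
  let R : ∀ n, X n → X (n + 1) → Prop := fun n x y =>
    J.IsLieStep n (hlt n) x.1.1 x.2.norm_le_one x.1.2 y.1.1 y.1.2 ∧
      Summable (OpenOpFamily.expTerm (-(J.gen n le_rfl x.1.1 x.1.2)) (hlt n)
        (A.f.val n (S n) + (x.1.1 : A.E.fib n (S n)) + (x.1.2 : A.E.fib n (S n)))) ∧
      ∀ (s : Pos) (hs : s ≤ S (n + 1)), L ≤ s →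
        ‖Tr.T.res le_rfl hs (y.1.1 - Tr.T.res (coe_le_coe_succ n) (hlt n).le x.1.1)‖ ≤
          H * (1 / 2) ^ (n + 2) * ((s : ℝ) / P (n + 1)) ^ profileOrder n
  obtain ⟨x, hx0, hx⟩ := exists_dependent_seq (X := X) ⟨(0, A.M.res le_rfl hS0 r₀), hx₀⟩ (R := R)
    (by
      rintro n ⟨⟨d, r⟩, hin⟩
      obtain ⟨d', r', h₁, h₂, h₃, h₄⟩ :=
        (h n).exists_step hk hS (hA n) hH hH1 (hlt n) (hPS n) (hS1 n) d r hin
      exact ⟨⟨(d', r'), h₁⟩, h₂, h₃, h₄⟩)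
  have hd : ∀ n, ‖Tr.T.res le_rfl (hsS n) (x n).1.1‖ ≤ 1 := fun n =>
    (Tr.T.norm_res_le _ _ _).trans (x n).2.norm_le_one
  have hstep := fun n => (hx n).1.restrict (hx n).2.1 (hsS n) (hsS (n + 1)) (s.succ_lt n) (hd n)
  let I : LieIteration J s :=
    { d := fun n => Tr.T.res le_rfl (hsS n) (x n).1.1
      r := fun n => A.M.res le_rfl (hsS n) (x n).1.2
      inc := fun n => Tr.T.res le_rfl (hsS (n + 1)) (x (n + 1)).1.1 -
        Tr.T.res (coe_le_coe_succ n) (s.succ_lt n).le (Tr.T.res le_rfl (hsS n) (x n).1.1)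
      d_zero := by
        rw [hx0]
        exact Subtype.ext (map_zero _)
      d_le := hd
      small := fun n => by
        have hρ := stepRatio_pos n
        let p : Pos := ⟨stepRatio n * s.val (n + 1), mul_pos hρ (s.val (n + 1)).2⟩
        have hpP : (p : ℝ) ≤ P n / 2 := by
          change stepRatio n * s.val (n + 1) ≤ P n / 2
          rw [hs1]
          linarith [hS.ratio_mul_lt n]
        have hps : p ≤ s.val n := hpP.trans (hPs n)
        have hsP : (s.val (n + 1) : ℝ) ≤ P (n + 1) := by rw [hs1]; linarith [hP (n + 1)]
        refine (h n).exists_locNorm_lt (stepGap_pos hS.L_pos n) _ (hd n) _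
          ((stepGap_le hS.L_pos n).trans (hLs _)) (p := p) (add_stepGap_le hS.L_pos (hLs _) n)
          (by linarith [hS.P_le n, hP n]) hps ?_
        -- Smallness is proved at the halved radius from the unrestricted state: `stepRatio n *
        -- s_{n+1}` is still at most `P n / 2 ≤ s_n`.
        rw [hA, A.M.res_res]
        exact ((x n).2.const_mul_norm_le hS hH (hLs (n + 1)) hsP rfl (hps.trans (hsS n))).trans
          ((half_bound hS hH1 n (s.val (n + 1)).2 hsP).trans (half_pow_le_half n))
      inc_eq := fun n => by
        rw [Submodule.coe_sub, (hstep n).1, A1Subspace.coe_res Tr.T _ (s.succ_lt n).le]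
        abel
      d_succ := fun n => (add_sub_cancel _ _).symm
      x_succ := fun n => (hstep n).2 }
  refine ⟨I, ?_, fun n => ?_, fun n => ?_⟩
  · change A.M.res le_rfl (hsS 0) (x 0).1.2 = r₀
    rw [hx0]
    exact (A.M.res_res _ _ _ _ _).trans (A.M.res_self _)
  · cases n with
    | zero =>
      rw [profileOrder_zero, pow_zero, mul_one]
      change ‖A.M.res le_rfl (hsS 0) (x 0).1.2‖ ≤ H
      rw [hx0]
      refine (A.M.norm_res_le _ _ _).trans ((A.M.norm_res_le _ _ _).trans (hr₀.trans ?_))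
      exact mul_le_of_le_one_right hH (hS.G_le 0)
    | succ n =>
      have h₁ := (x (n + 1)).2.2 (s.val (n + 1)) (hsS (n + 1)) (hLs _)
        (by rw [hs1]; linarith [hP (n + 1)])
      refine h₁.trans ?_
      have e : (s.val (n + 1) : ℝ) / P (n + 1) = 1 / 2 := by
        have := (hP (n + 1)).ne'
        rw [hs1]; field_simp
      rw [e]
      have hG := hS.G_le (n + 1)
      calc _ ≤ H * (1 * (1 / 2) ^ profileOrder (n + 1)) := by gcongr
        _ = _ := by rw [one_mul]
  · have h₁ := (hx n).2.2 (s.val (n + 1)) (hsS (n + 1)) (hLs _)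
    have e : (s.val (n + 1) : ℝ) / P (n + 1) = 1 / 2 := by
      have := (hP (n + 1)).ne'
      rw [hs1]; field_simp
    rw [e] at h₁
    refine le_trans (le_of_eq ?_) h₁
    congr 1
    apply Subtype.ext
    simp only [I, Submodule.coe_sub, A1Subspace.coe_res, map_sub, A.E.res_res]

end LocalInverse

/-! ### Comparisons with Bruno sequences. -/

theorem tendsto_half_pow_profileOrder :
    Tendsto (fun n => (1 / 2 : ℝ) ^ profileOrder n) atTop (𝓝 0) := by
  refine (tendsto_pow_atTop_nhds_zero_of_lt_one (by norm_num) (by norm_num)).comp ?_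
  rw [← tendsto_add_atTop_iff_nat 1]
  simp only [profileOrder_succ]
  exact tendsto_pow_atTop_atTop_of_one_lt one_lt_two

/-- Bruno sequences decay slower than `2^(-2^(n-1))`. -/
theorem IsBruno.exists_half_pow_le {b : ℕ → ℝ} (hb : IsBruno b) :
    ∃ C : ℝ, 1 ≤ C ∧ ∀ n, (1 / 2 : ℝ) ^ profileOrder n ≤ C * b (n + 1) := by
  obtain ⟨-, hpos, hsum⟩ := hb
  have h₁ := (hsum.tendsto_atTop_zero.comp (tendsto_add_atTop_nat 1)).eventually
    (gt_mem_nhds (show (0 : ℝ) < 1 / 16 by norm_num))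
  -- Eventually `|log b_{n+1}| < 2^(n+2)/16 = profileOrder n / 2`, which is less than `profileOrder
  -- n * log 2`; the finitely many other indices go into `C`.
  have h₂ : ∀ᶠ n in atTop, (1 / 2 : ℝ) ^ profileOrder n / b (n + 1) ≤ 1 := by
    filter_upwards [h₁, eventually_ge_atTop 1] with n hn hn1
    rw [div_le_one (hpos _), ← Real.log_le_log_iff (by positivity) (hpos _), Real.log_pow,
      one_div, Real.log_inv]
    simp only [Function.comp_apply, abs_div, abs_pow, Nat.abs_ofNat] at hn
    have h₃ : (profileOrder n : ℝ) * 8 = 2 ^ (n + 2) := by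
      have := two_mul_profileOrder hn1
      have h₄ : (2 : ℝ) * profileOrder n = 2 ^ n := by exact_mod_cast this
      rw [pow_add, ← h₄]; ring
    rw [div_lt_iff₀ (by positivity), ← h₃] at hn
    have h₅ := neg_abs_le (Real.log (b (n + 1)))
    have h₆ := Real.log_two_gt_d9
    have h₇ : (0 : ℝ) ≤ profileOrder n := Nat.cast_nonneg _
    nlinarith
  obtain ⟨C, hC⟩ := (isBoundedUnder_of_eventually_le h₂).bddAbove_range
  refine ⟨max C 1, le_max_right _ _, fun n => ?_⟩
  rw [← div_le_iff₀ (hpos _)]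
  exact (hC ⟨n, rfl⟩).trans (le_max_left _ _)

/-- Adding `1` makes the bounds at least `1`, as the step constants require, and preserves
summability since `log (1 + b) ≤ |log b| + log 2`. -/
theorem IsBruno.summable_log_one_add {b : ℕ → ℝ} (hb : IsBruno b) :
    Summable fun n => Real.log (1 + b n) / 2 ^ n := by
  obtain ⟨-, hpos, hsum⟩ := hb
  have h₂ : Summable fun n : ℕ => (1 / 2 : ℝ) ^ n :=
    summable_geometric_of_lt_one (by norm_num) (by norm_num)
  refine .of_nonneg_of_le (fun n => ?_) (fun n => ?_) ((hsum.mul_left 2).add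
    (h₂.mul_left (Real.log 2)))
  · exact div_nonneg (Real.log_nonneg (by linarith [hpos n])) (by positivity)
  · have h₁ : Real.log (1 + b n) ≤ |Real.log (b n)| + Real.log 2 := by
      rcases le_total (b n) 1 with hle | hle
      · have : Real.log (1 + b n) ≤ Real.log 2 :=
          Real.log_le_log (by linarith [hpos n]) (by linarith)
        linarith [abs_nonneg (Real.log (b n))]
      · have : Real.log (1 + b n) ≤ Real.log (b n * 2) :=
          Real.log_le_log (by linarith [hpos n]) (by linarith)
        rw [Real.log_mul (hpos n).ne' two_ne_zero] at this
        linarith [le_abs_self (Real.log (b n))]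
    rw [abs_div, abs_of_pos (by positivity : (0 : ℝ) < 2 ^ (n + 1)), pow_succ, one_div_pow]
    calc _ ≤ (|Real.log (b n)| + Real.log 2) / 2 ^ n := by gcongr
      _ = _ := by field_simp

theorem summable_log_stepConst {a : ℕ → ℝ} (ha : ∀ n, 1 ≤ a n)
    (hs : Summable fun n => Real.log (a n) / 2 ^ n) {F : ℝ} (hF : 0 ≤ F) (N : ℕ) :
    Summable fun n : ℕ => Real.log (16 * a n ^ 2 * (F + 1) * (8 * 2 ^ n) ^ N) / 2 ^ n := by
  have h₁ : Summable fun n : ℕ => ((n : ℝ) ^ 1 * (1 / 2 : ℝ) ^ n) :=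
    summable_pow_mul_geometric_of_norm_lt_one 1 (by norm_num)
  have h₂ : Summable fun n : ℕ => (1 / 2 : ℝ) ^ n :=
    summable_geometric_of_lt_one (by norm_num) (by norm_num)
  refine (((hs.mul_left 2).add (h₁.mul_left (N * Real.log 2))).add
    (h₂.mul_left (Real.log 16 + Real.log (F + 1) + N * Real.log 8))).congr fun n => ?_
  have ha0 : a n ≠ 0 := (one_pos.trans_le (ha n)).ne'
  rw [Real.log_mul (by positivity) (by positivity), Real.log_mul (by positivity) (by positivity),
    Real.log_mul (by positivity) (by positivity), Real.log_pow, Real.log_pow,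
    Real.log_mul (by positivity) (by positivity), Real.log_pow, one_div_pow]
  push_cast
  field_simp
  ring

end

/-! ### Choice of the constants and conclusion. -/

theorem theoremT (k : ℝ) (hk : 0 < k) (α β γ ν ξ : ℝ × ℝ) :
    ∃ m : ℝ, 0 < m ∧
      ∀ (A : ArnoldAction k) (Tr : Transversal A) (J : LocalInverse Tr),
        (∀ S : Pos, BrunoBounded (Tr.projNorm α S)) →
        (∀ S : Pos, BrunoBounded (J.norm β γ S)) →
        (∀ S : Pos, BrunoBounded (J.defectNorm ν ξ S)) →
        ∃ ε : ℝ, 0 < ε ∧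
          ∀ b : ℕ → ℝ, IsBruno b → StrictAnti b → IsStrictSeq b →
            ∃ εb : ℝ, 0 < εb ∧ εb ≤ ε ∧
              ∀ t : Pos, ∃ s : FallingSeq, s.val 0 = t ∧
                ∀ r₀ : A.M.car (0 : ℕ) (s.val 0), ‖r₀‖ < ε * (min 1 (t : ℝ)) ^ m →
                  ∃ L : LieIteration J s, L.r 0 = r₀ ∧ L.Converges ∧
                    (‖r₀‖ < εb * (min 1 (t : ℝ)) ^ m →
                      (∀ n, ‖L.r n‖ ≤ b n) ∧ ∀ n, ‖L.inc n‖ ≤ b (n + 1)) := by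
  obtain ⟨K, hK⟩ := exists_nat_ge (k + (|α.1| + |α.2|) + (|β.1| + |β.2|) + (|γ.1| + |γ.2|) +
    (|ν.1| + |ν.2|) + (|ξ.1| + |ξ.2|))
  obtain ⟨N, hN⟩ : ∃ N, N = 10 * K + 2 := ⟨_, rfl⟩
  -- Any `n₀ ≥ 1` with `8 * N ≤ 2^n₀` would do; what matters is that it depends on the exponents
  -- only, hence so does `m`.
  obtain ⟨n₀, hn₀⟩ : ∃ n₀, n₀ = 8 * N + 1 := ⟨_, rfl⟩
  have hNn : 8 * N ≤ 2 ^ n₀ := (by omega : 8 * N ≤ n₀).trans Nat.lt_two_pow_self.le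
  refine ⟨((2 * (N + 2 ^ n₀) * n₀ : ℕ) : ℝ), by
    have : 0 < n₀ := by omega
    have : 0 < N := by omega
    positivity, fun A Tr J hπ hj hκ => ?_⟩
  obtain ⟨a₁, ha₁, hπ⟩ := hπ ⟨1, one_pos⟩
  obtain ⟨a₂, ha₂, hj⟩ := hj ⟨1, one_pos⟩
  obtain ⟨a₃, ha₃, hκ⟩ := hκ ⟨1, one_pos⟩
  -- A common majorant of the three norms whose logarithm is a sum of summable pieces; it need not
  -- be monotone.
  let a : ℕ → ℝ := fun n => (1 + a₁ n) * (1 + a₂ n) * (1 + a₃ n)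
  have p₁ : ∀ n, 0 < a₁ n := ha₁.2.1
  have p₂ : ∀ n, 0 < a₂ n := ha₂.2.1
  have p₃ : ∀ n, 0 < a₃ n := ha₃.2.1
  have hale : ∀ n, 1 + a₁ n + a₂ n + a₃ n ≤ a n := fun n => by
    have h₁ := p₁ n
    have h₂ := p₂ n
    have h₃ := p₃ n
    have : a n = 1 + a₁ n + a₂ n + a₃ n + (a₁ n * a₂ n + a₁ n * a₃ n + a₂ n * a₃ n +
      a₁ n * a₂ n * a₃ n) := by simp only [a]; ring
    have : 0 < a₁ n * a₂ n + a₁ n * a₃ n + a₂ n * a₃ n + a₁ n * a₂ n * a₃ n := by positivity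
    linarith
  have ha1 : ∀ n, 1 ≤ a n := fun n => by linarith [hale n, p₁ n, p₂ n, p₃ n]
  have has : Summable fun n => Real.log (a n) / 2 ^ n := by
    refine ((ha₁.summable_log_one_add.add ha₂.summable_log_one_add).add
      ha₃.summable_log_one_add).congr fun n => ?_
    have h₁ := p₁ n
    have h₂ := p₂ n
    have h₃ := p₃ n
    simp only [a]
    rw [Real.log_mul (by positivity) (by positivity), Real.log_mul (by positivity) (by positivity),
      add_div, add_div]
  set F := ‖A.f.val (0 : ℕ) ⟨1, one_pos⟩‖ with hF
  have hF0 : 0 ≤ F := norm_nonneg _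
  have hdata : ∀ n, J.StepData α β γ ν ξ K n (a n) F := fun n => by
    have q₁ := abs_nonneg α.1
    have q₂ := abs_nonneg α.2
    have q₃ := abs_nonneg β.1
    have q₄ := abs_nonneg β.2
    have q₅ := abs_nonneg γ.1
    have q₆ := abs_nonneg γ.2
    have q₇ := abs_nonneg ν.1
    have q₈ := abs_nonneg ν.2
    have q₉ := abs_nonneg ξ.1
    have q₀ := abs_nonneg ξ.2
    have h₁ := p₁ n
    have h₂ := p₂ n
    have h₃ := p₃ n
    have hle := hale n
    refine ⟨ha1 n, (hπ n).trans (ENNReal.ofReal_le_ofReal (by linarith)),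
      (hj n).trans (ENNReal.ofReal_le_ofReal (by linarith)),
      (hκ n).trans (ENNReal.ofReal_le_ofReal (by linarith)), fun s hs => ?_, by linarith,
      ⟨?_, ?_⟩, ⟨?_, ?_⟩, ⟨?_, ?_⟩, ⟨?_, ?_⟩, ⟨?_, ?_⟩⟩
    · rw [← A.f.horizontal (Nat.cast_le.2 (Nat.zero_le n)) (show s ≤ ⟨1, one_pos⟩ from hs)]
      exact A.E.norm_res_le _ _ _
    · linarith [le_abs_self α.1]
    · linarith [le_abs_self α.2]
    · linarith [le_abs_self β.1]
    · linarith [le_abs_self β.2]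
    · linarith [le_abs_self γ.1]
    · linarith [le_abs_self γ.2]
    · linarith [le_abs_self ν.1]
    · linarith [le_abs_self ν.2]
    · linarith [le_abs_self ξ.1]
    · linarith [le_abs_self ξ.2]
  -- The step constant at gap `L / (8 * 2^n)` with its power of `L` removed, so that `B` is
  -- independent of `t`.
  let B : ℕ → ℝ := fun n => 16 * a n ^ 2 * (F + 1) * (8 * 2 ^ n) ^ N
  have hB1 : ∀ n, 1 ≤ B n := fun n => by
    have h₁ : 1 ≤ a n ^ 2 := one_le_pow₀ (ha1 n)
    have h₂ : (1 : ℝ) ≤ (8 * 2 ^ n) ^ N :=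
      one_le_pow₀ (one_le_mul_of_one_le_of_one_le (by norm_num) (one_le_pow₀ one_le_two))
    exact one_le_mul_of_one_le_of_one_le (one_le_mul_of_one_le_of_one_le
      (one_le_mul_of_one_le_of_one_le (by norm_num) h₁) (by linarith)) h₂
  obtain ⟨ε, hε, hsched⟩ := exists_isSchedule (by omega : 1 ≤ n₀) hNn hB1
    (summable_log_stepConst ha1 has hF0 N)
  refine ⟨ε, hε, fun b hb hbanti _ => ?_⟩
  obtain ⟨C, hC1, hC⟩ := hb.exists_half_pow_le
  have hC0 : 0 < C := one_pos.trans_le hC1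
  -- All bounds are linear in `H = ‖r₀‖ / G 0`, so dividing the threshold by `C` turns
  -- `(1/2)^(profileOrder n) ≤ C * b (n+1)` into the required decay.
  refine ⟨ε / C, by positivity, div_le_self hε.le hC1, fun t => ?_⟩
  have hτ : 0 < min 1 (t : ℝ) := lt_min one_pos t.2
  obtain ⟨L, P, G, hS, hP0, hG0⟩ := hsched (min 1 t) hτ (min_le_left _ _)
  have ht : P 0 ≤ t := hP0.le.trans (min_le_right _ _)
  obtain ⟨s, hs⟩ := hS.exists_fallingSeq ht
  refine ⟨s, by rw [hs]; rfl, fun r₀ hr₀ => ?_⟩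
  rw [Real.rpow_natCast, ← hG0] at hr₀
  have hGpos := hS.G_pos 0
  have hA : ∀ n, LocalInverse.stepConst K (a n) F (stepGap L n) = B n / L ^ N := fun n => by
    have := hS.L_pos
    simp only [LocalInverse.stepConst, stepGap, B]
    rw [div_pow, hN]
    field_simp
  have hH0 : 0 ≤ ‖r₀‖ / G 0 := by positivity
  have hH1 : ‖r₀‖ / G 0 ≤ 1 := (div_le_one hGpos).2 hr₀.le
  obtain ⟨I, hI0, hIr, hIinc⟩ := J.exists_lieIteration hk hdata hS hA hH0 hH1 hs ht r₀
    (div_mul_cancel₀ _ hGpos.ne').ge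
  have hhalf : ∀ j : ℕ, (1 / 2 : ℝ) ^ j ≤ 1 := fun j =>
    pow_le_one₀ (by norm_num) (by norm_num)
  refine ⟨I, hI0, I.converges_of_norm_inc_le (fun n => (hIinc n).trans ?_) ?_, fun hr₀b => ?_⟩
  · have h₁ : (1 / 2 : ℝ) ^ (n + 2) ≤ (1 / 2) ^ (n + 1) :=
      pow_le_pow_of_le_one (by norm_num) (by norm_num) (by omega)
    have h₂ := hhalf (profileOrder n)
    calc _ ≤ 1 * (1 / 2 : ℝ) ^ (n + 1) * 1 := by gcongr
      _ = _ := by ring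
  · refine squeeze_zero (fun n => norm_nonneg _) hIr ?_
    simpa using tendsto_half_pow_profileOrder.const_mul (‖r₀‖ / G 0)
  · have hHC : ‖r₀‖ / G 0 ≤ 1 / C := by
      rw [Real.rpow_natCast, div_mul_eq_mul_div, ← hG0] at hr₀b
      rw [div_le_div_iff₀ hGpos hC0, one_mul]
      rw [lt_div_iff₀ hC0] at hr₀b
      exact hr₀b.le
    have hb1 : ∀ n, ‖r₀‖ / G 0 * (1 / 2) ^ profileOrder n ≤ b (n + 1) := fun n => by
      calc _ ≤ 1 / C * (C * b (n + 1)) := mul_le_mul hHC (hC n) (by positivity) (by positivity)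
        _ = _ := by field_simp
    refine ⟨fun n => (hIr n).trans ((hb1 n).trans (hbanti n.lt_succ_self).le), fun n =>
      (hIinc n).trans (le_trans ?_ (hb1 n))⟩
    have := hhalf (n + 2)
    calc _ ≤ ‖r₀‖ / G 0 * 1 * (1 / 2) ^ profileOrder n := by gcongr
      _ = _ := by rw [mul_one]
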